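/- Let $q\ge 0$ and $n$ be integers with $n-q\ge 2$, and let $\mathcal S(q,n)$ be the set of oriented round $q$-spheres in the unit sphere $S^n\subset\mathbb R^{n+1}$ (an orientation of $\Sigma$ is understood as an orientation of the $(q+1)$-ball bounded by $\Sigma$ in its affine hull; for $q=0$ it is an ordering of the two points of $\Sigma$). Let $\mathbb R^{n+2}_1$ be $\mathbb R^{n+2}$ with the Minkowski form $\langle x,y\rangle=-x_0y_0+x_1y_1+\cdots+x_{n+1}y_{n+1}$, in which $x\in S^n$ is represented by the lightlike vector $(1,x)$. For $\Sigma\in\mathcal S(q,n)$ let $\Pi_\Sigma\subset\mathbb R^{n+2}_1$ be the linear span of the vectors $(1,x)$, $x\in\Sigma$, oriented by the bases $(1,x),(0,b_0),\dots,(0,b_q)$ with $x\in\Sigma$ and $b_0,\dots,b_q$ a basis giving the orientation of $\Sigma$. On $\bigwedge^{q+2}\mathbb R^{n+2}_1\cong\mathbb R^N$, $N=\binom{n+2}{q+2}$, consider the bilinear form with $\langle e_I,e_J\rangle=-\det(\langle e_{i_k},e_{j_l}\rangle)_{k,l}$, and let $\psi:\mathcal S(q,n)\to\mathbb R^N$ be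 given by $$\psi(\Sigma)=\frac{x_1\wedge\cdots\wedge x_{q+2}}{\sqrt{\langle x_1\wedge\cdots\wedge x_{q+2},\,x_1\wedge\cdots\wedge x_{q+2}\rangle}}$$ for any basis $x_1,\dots,x_{q+2}$ of $\Pi_\Sigma$ giving its orientation. Then: 1. $\Sigma\mapsto\Pi_\Sigma$ is a bijection from $\mathcal S(q,n)$ onto the set of oriented $(q+2)$-dimensional linear subspaces $\Pi$ of $\mathbb R^{n+2}_1$ on which the Minkowski form is non-degenerate of index $1$ (those that intersect the light cone transversally). Through it $SO(n+1,1)$ acts on $\mathcal S(q,n)$: $\Pi_{A\cdot\Sigma}=A\,\Pi_\Sigma$. 2. $\mathcal S(q,n)$ is a smooth manifold of dimension $(q+2)(n-q)$ (the structure for which $\psi$ is a smooth embedding), so that every tangent space has this dimension. The action of $SO(n+1,1)$ is smooth, and $\mathcal S(q,n)$ is the homogeneous space $SO(n+1,1)/\bigl(SO(n-q)\times SO(q+1,1)\bigr)$: it is $SO(n+1,1)$-equivariantly homeomorphic to this quotient, where $SO(n-q)\times SO(q+1,1)$ is the subgroup of block diagonal matrices $\mathrm{diag}(B,C)$ with $B\in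 SO(q+1,1)$, $C\in SO(n-q)$. 3. $\mathcal S(q,n)$ carries a smooth pseudo-Riemannian metric $g$ (a smooth, symmetric, non-degenerate bilinear form on the tangent spaces) which is natural, namely induced by the Minkowski form, $g(u,v)=\langle d\psi(u),d\psi(v)\rangle$, and invariant under $SO(n+1,1)$, and which has index $n-q$: every tangent space is a direct sum $T_\Sigma\mathcal S(q,n)=V_+\oplus V_-$ with $\dim V_+=(q+1)(n-q)$, $\dim V_-=n-q$, such that $g$ is positive definite on $V_+$ and negative definite on $V_-$. -/

import Mathlib

open scoped Manifold ContDiff Topology Matrix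
open Module

noncomputable section

namespace SphereSpace

/-! ### Minkowski space -/

/-- The matrix `diag(-1, 1, …, 1)` of size `m`. -/
def minkowskiMatrix (m : ℕ) : Matrix (Fin m) (Fin m) ℝ :=
  Matrix.diagonal fun i => if i.val = 0 then -1 else 1

/-- The bilinear form `-x₀y₀ + x₁y₁ + ⋯ + x_{m-1}y_{m-1}` on `ℝᵐ`. -/
def minkowskiForm (m : ℕ) : LinearMap.BilinForm ℝ (Fin m → ℝ) :=
  Matrix.toBilin' (minkowskiMatrix m)

/-- The group of matrices of determinant one that preserve the bilinear form with matrix `J`. -/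
def specialIsometryGroup {m : ℕ} (J : Matrix (Fin m) (Fin m) ℝ) :
    Subgroup (GL (Fin m) ℝ) where
  carrier := {A | (A : Matrix (Fin m) (Fin m) ℝ)ᵀ * J * (A : Matrix (Fin m) (Fin m) ℝ) = J ∧
    (A : Matrix (Fin m) (Fin m) ℝ).det = 1}
  one_mem' := by simp
  mul_mem' := by
    rintro A B ⟨hA, hA'⟩ ⟨hB, hB'⟩
    refine ⟨?_, by simp [hA', hB']⟩
    calc _ = (B : Matrix (Fin m) (Fin m) ℝ)ᵀ *
          ((A : Matrix (Fin m) (Fin m) ℝ)ᵀ * J * (A : Matrix (Fin m) (Fin m) ℝ)) *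
          (B : Matrix (Fin m) (Fin m) ℝ) := by
          simp [Matrix.transpose_mul, Matrix.mul_assoc]
      _ = J := by rw [hA, hB]
  inv_mem' := by
    rintro A ⟨hA, hA'⟩
    have h1 : (A : Matrix (Fin m) (Fin m) ℝ) * ((A⁻¹ : GL (Fin m) ℝ) : Matrix _ _ ℝ) = 1 :=
      A.mul_inv
    have h2 : ((A⁻¹ : GL (Fin m) ℝ) : Matrix (Fin m) (Fin m) ℝ)ᵀ *
        (A : Matrix (Fin m) (Fin m) ℝ)ᵀ = 1 := by
      rw [← Matrix.transpose_mul, h1, Matrix.transpose_one]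
    refine ⟨?_, ?_⟩
    · generalize ((A⁻¹ : GL (Fin m) ℝ) : Matrix (Fin m) (Fin m) ℝ) = C at *
      calc Cᵀ * J * C = Cᵀ * ((A : Matrix (Fin m) (Fin m) ℝ)ᵀ * J * A) * C := by rw [hA]
        _ = (Cᵀ * (A : Matrix (Fin m) (Fin m) ℝ)ᵀ) * J * (A * C) := by
          simp only [Matrix.mul_assoc]
        _ = J := by rw [h1, h2]; simp
    · have := congrArg Matrix.det h1
      rw [Matrix.det_mul, hA', one_mul, Matrix.det_one] at this
      exact this

/-- The Lorentz group `SO(m - 1, 1)`, acting on `m`-dimensional Minkowski space. -/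
abbrev SOLorentz (m : ℕ) : Subgroup (GL (Fin m) ℝ) := specialIsometryGroup (minkowskiMatrix m)

/-- The linear automorphism `x ↦ A x` of `ℝᵐ`. -/
def glEquiv {m : ℕ} (A : GL (Fin m) ℝ) : (Fin m → ℝ) ≃ₗ[ℝ] (Fin m → ℝ) :=
  (Matrix.GeneralLinearGroup.toLin A).toLinearEquiv

theorem glEquiv_one {m : ℕ} (v : Fin m → ℝ) : glEquiv (1 : GL (Fin m) ℝ) v = v := by
  simp [glEquiv]

theorem glEquiv_mul {m : ℕ} (A B : GL (Fin m) ℝ) (v : Fin m → ℝ) :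
    glEquiv (A * B) v = glEquiv A (glEquiv B v) := by
  simp [glEquiv]

theorem glEquiv_apply {m : ℕ} (A : GL (Fin m) ℝ) (v : Fin m → ℝ) :
    glEquiv A v = (A : Matrix (Fin m) (Fin m) ℝ) *ᵥ v := by
  simp [glEquiv, Matrix.GeneralLinearGroup.toLin]

theorem minkowskiForm_glEquiv {m : ℕ} (A : SOLorentz m) (v w : Fin m → ℝ) :
    minkowskiForm m (glEquiv A v) (glEquiv A w) = minkowskiForm m v w := by
  have h := A.2.1
  rw [glEquiv_apply, glEquiv_apply, minkowskiForm, Matrix.toBilin'_apply', Matrix.toBilin'_apply',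
    Matrix.mulVec_mulVec, ← Matrix.vecMul_transpose, ← Matrix.dotProduct_mulVec,
    Matrix.mulVec_mulVec, ← Matrix.mul_assoc, h]


theorem minkowskiForm_apply {m : ℕ} (v w : Fin (m + 1) → ℝ) :
    minkowskiForm (m + 1) v w = -(v 0 * w 0) + ∑ i : Fin m, v i.succ * w i.succ := by
  simp [minkowskiForm, minkowskiMatrix, Matrix.toBilin'_apply', Matrix.mulVec_diagonal,
    dotProduct, Fin.sum_univ_succ]

theorem minkowskiForm_comm {m : ℕ} (v w : Fin (m + 1) → ℝ) :
    minkowskiForm (m + 1) v w = minkowskiForm (m + 1) w v := by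
  simp only [minkowskiForm_apply, mul_comm]

theorem eq_zero_of_orthogonal_timelike {m : ℕ} {v w : Fin (m + 1) → ℝ}
    (hv : minkowskiForm (m + 1) v v < 0) (hw : minkowskiForm (m + 1) w w ≤ 0)
    (hvw : minkowskiForm (m + 1) v w = 0) : w = 0 := by
  rw [minkowskiForm_apply] at hv hw hvw
  have hcs := Finset.sum_mul_sq_le_sq_mul_sq Finset.univ (fun i : Fin m => v i.succ)
    (fun i => w i.succ)
  simp only [pow_two] at hcs
  have e : ∑ i : Fin m, v i.succ * w i.succ = v 0 * w 0 := by linarith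
  rw [e] at hcs
  have hw0 : 0 ≤ ∑ i : Fin m, w i.succ * w i.succ :=
    Finset.sum_nonneg fun i _ => mul_self_nonneg _
  have hv0 : 0 ≤ ∑ i : Fin m, v i.succ * v i.succ :=
    Finset.sum_nonneg fun i _ => mul_self_nonneg _
  have hz : w 0 * w 0 = 0 := by
    by_contra hne
    have hpos : 0 < w 0 * w 0 := lt_of_le_of_ne (mul_self_nonneg _) (Ne.symm hne)
    nlinarith
  have hs : ∑ i : Fin m, w i.succ * w i.succ = 0 := by linarith
  rw [Finset.sum_eq_zero_iff_of_nonneg fun i _ => mul_self_nonneg _] at hs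
  funext i
  refine Fin.cases ?_ (fun i => ?_) i
  · simpa using hz
  · simpa using hs i (Finset.mem_univ _)

/-- The restriction of the Minkowski quadratic form to a subspace. -/
def restrictedForm {m : ℕ} (W : Submodule ℝ (Fin m → ℝ)) : QuadraticForm ℝ W :=
  (minkowskiForm m).toQuadraticMap.restrict W

theorem restrictedForm_apply {m : ℕ} (W : Submodule ℝ (Fin m → ℝ)) (w : W) :
    restrictedForm W w = minkowskiForm m w w := rfl

theorem nondegenerate_of_timelike {m : ℕ} {W : Submodule ℝ (Fin (m + 1) → ℝ)}
    {v : Fin (m + 1) → ℝ} (hvW : v ∈ W) (hv : minkowskiForm (m + 1) v v < 0) :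
    ((minkowskiForm (m + 1)).restrict W).Nondegenerate := by
  have key : ∀ w : W, (∀ u : W, minkowskiForm (m + 1) u w = 0) → w = 0 := fun w hw =>
    Subtype.ext (eq_zero_of_orthogonal_timelike hv (hw w).le (hw ⟨v, hvW⟩))
  refine ⟨fun w hw => key w fun u => ?_, fun w hw => key w fun u => hw u⟩
  rw [minkowskiForm_comm]; exact hw u

theorem sigNeg_of_timelike {m : ℕ} {W : Submodule ℝ (Fin (m + 1) → ℝ)}
    {v : Fin (m + 1) → ℝ} (hvW : v ∈ W) (hv : minkowskiForm (m + 1) v v < 0) :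
    sigNeg (restrictedForm W) = 1 := by
  apply le_antisymm
  · obtain ⟨U, hU, hneg⟩ := exists_finrank_eq_sigNeg_and_negDef (restrictedForm W)
    rw [← hU]
    let f : U →ₗ[ℝ] ℝ := (LinearMap.proj (0 : Fin (m + 1))).comp (W.subtype.comp U.subtype)
    have hf : Function.Injective f := by
      intro a b hab
      by_contra hne
      obtain ⟨u, hu⟩ : ∃ u, u = a - b := ⟨_, rfl⟩
      have h1 := hneg u (by rw [hu]; exact sub_ne_zero.2 hne)
      have h2 : ((u : W) : Fin (m + 1) → ℝ) 0 = 0 := by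
        rw [hu]
        exact sub_eq_zero.2 hab
      have h3 : 0 < -restrictedForm W (u : W) := h1
      rw [restrictedForm_apply, minkowskiForm_apply, h2] at h3
      have : 0 ≤ ∑ i : Fin m, ((u : W) : Fin (m + 1) → ℝ) i.succ *
        ((u : W) : Fin (m + 1) → ℝ) i.succ := Finset.sum_nonneg fun i _ => mul_self_nonneg _
      linarith
    simpa using LinearMap.finrank_le_finrank_of_injective hf
  · have hne : (⟨v, hvW⟩ : W) ≠ 0 := by
      intro h
      have : v = 0 := congrArg Subtype.val h
      simp [this] at hv
    refine (finrank_span_singleton (K := ℝ) hne).symm.le.trans (le_sigNeg_of_negDef _ ?_)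
    rintro ⟨x, hx⟩ hx0
    obtain ⟨c, rfl⟩ := Submodule.mem_span_singleton.1 hx
    have hc : c ≠ 0 := by
      rintro rfl
      exact hx0 (Subtype.ext (zero_smul _ _))
    change 0 < -restrictedForm W (c • ⟨v, hvW⟩)
    rw [QuadraticMap.map_smul, restrictedForm_apply, smul_eq_mul]
    have := mul_self_pos.2 hc
    nlinarith

/-! ### Oriented Lorentzian planes -/

/-- An oriented `(q + 2)`-dimensional linear subspace `Π` of the Minkowski space `ℝ^{n+2}` that
intersects the light cone transversally, which means that `Π` is again a Minkowski space: the
restriction of the Minkowski form to `Π` is non-degenerate and of index one. -/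
structure LorentzPlane (q n : ℕ) where
  carrier : Submodule ℝ (Fin (n + 2) → ℝ)
  finrank_carrier : finrank ℝ carrier = q + 2
  nondegenerate : ((minkowskiForm (n + 2)).restrict carrier).Nondegenerate
  index_eq_one : sigNeg (restrictedForm carrier) = 1
  orientation : Orientation ℝ carrier (Fin (q + 2))

namespace LorentzPlane

variable {q n : ℕ}

theorem ext_map {P Q : LorentzPlane q n} (h : P.carrier = Q.carrier)
    (ho : Orientation.map (Fin (q + 2)) (LinearEquiv.ofEq _ _ h) P.orientation = Q.orientation) :
    P = Q := by
  obtain ⟨W, _, _, _, o⟩ := P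
  obtain ⟨W', _, _, _, o'⟩ := Q
  dsimp only at h
  subst h
  have : LinearEquiv.ofEq W W rfl = LinearEquiv.refl ℝ W := rfl
  simp only [this, Orientation.map_refl, Equiv.refl_apply] at ho
  rw [ho]

theorem orientation_map_map {M N K : Type*} [AddCommGroup M] [Module ℝ M] [AddCommGroup N]
    [Module ℝ N] [AddCommGroup K] [Module ℝ K] {ι : Type*} (e : M ≃ₗ[ℝ] N) (f : N ≃ₗ[ℝ] K)
    (o : Orientation ℝ M ι) :
    Orientation.map ι f (Orientation.map ι e o) = Orientation.map ι (e.trans f) o := by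
  induction o using Module.Ray.ind with
  | h v hv => rfl

/-- The image `A Π` of an oriented plane under `A ∈ SO(n + 1, 1)`, with the image orientation. -/
def map (A : SOLorentz (n + 2)) (P : LorentzPlane q n) : LorentzPlane q n where
  carrier := P.carrier.map (glEquiv (A : GL (Fin (n + 2)) ℝ) : (Fin (n + 2) → ℝ) →ₗ[ℝ] _)
  finrank_carrier := by rw [LinearEquiv.finrank_map_eq, P.finrank_carrier]
  nondegenerate := by
    have hP := P.nondegenerate
    have key : ∀ w ∈ P.carrier, (∀ u ∈ P.carrier, minkowskiForm (n + 2) w u = 0) → w = 0 :=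
      fun w hw h => congrArg Subtype.val (hP.1 ⟨w, hw⟩ fun u => h u u.2)
    have key2 : ∀ w : (P.carrier.map
        (glEquiv (A : GL (Fin (n + 2)) ℝ) : (Fin (n + 2) → ℝ) →ₗ[ℝ] (Fin (n + 2) → ℝ))),
        (∀ u ∈ P.carrier, minkowskiForm (n + 2) w (glEquiv (A : GL (Fin (n + 2)) ℝ) u) = 0) →
        w = 0 := by
      rintro ⟨_, w, hw, rfl⟩ h
      have : w = 0 := key w hw fun u hu => by
        rw [← minkowskiForm_glEquiv A]; exact h u hu
      subst this
      exact Subtype.ext (map_zero _)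
    refine ⟨fun w h => key2 w fun u hu => h ⟨_, u, hu, rfl⟩, fun w h => key2 w fun u hu => ?_⟩
    rw [minkowskiForm_comm]
    exact h ⟨_, u, hu, rfl⟩
  index_eq_one := by
    rw [← P.index_eq_one]
    refine (QuadraticMap.Equivalent.sigNeg_eq ⟨?_⟩).symm
    exact
      { (glEquiv (A : GL (Fin (n + 2)) ℝ)).submoduleMap P.carrier with
        map_app' := fun w => minkowskiForm_glEquiv A w w }
  orientation := Orientation.map (Fin (q + 2))
    ((glEquiv (A : GL (Fin (n + 2)) ℝ)).submoduleMap P.carrier) P.orientation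

theorem map_eq_of_equiv (A : SOLorentz (n + 2)) {P Q : LorentzPlane q n}
    (e : P.carrier ≃ₗ[ℝ] Q.carrier)
    (he : ∀ w, (e w : Fin (n + 2) → ℝ) = glEquiv (A : GL (Fin (n + 2)) ℝ) w)
    (ho : Orientation.map (Fin (q + 2)) e P.orientation = Q.orientation) : map A P = Q := by
  have h : (map A P).carrier = Q.carrier := by
    apply le_antisymm
    · rintro _ ⟨w, hw, rfl⟩
      have := (e ⟨w, hw⟩).2
      rwa [he] at this
    · intro w hw
      refine ⟨e.symm ⟨w, hw⟩, (e.symm ⟨w, hw⟩).2, ?_⟩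
      have := he (e.symm ⟨w, hw⟩)
      rw [e.apply_symm_apply] at this
      exact this.symm
  refine ext_map h ?_
  rw [← ho]
  refine (orientation_map_map ((glEquiv (A : GL (Fin (n + 2)) ℝ)).submoduleMap P.carrier)
    (LinearEquiv.ofEq _ _ h) P.orientation).trans ?_
  congr 2
  ext w : 2
  exact (he w).symm

/-- The action of `SO(n + 1, 1)` on oriented Lorentzian planes. -/
instance : MulAction (SOLorentz (n + 2)) (LorentzPlane q n) where
  smul := map
  one_smul P := map_eq_of_equiv 1 (LinearEquiv.refl ℝ P.carrier)
    (fun w => (glEquiv_one _).symm) (by rw [Orientation.map_refl]; rfl)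
  mul_smul A B P := map_eq_of_equiv (A * B)
    (((glEquiv (B : GL (Fin (n + 2)) ℝ)).submoduleMap P.carrier).trans
      ((glEquiv (A : GL (Fin (n + 2)) ℝ)).submoduleMap (map B P).carrier))
    (fun w => (glEquiv_mul _ _ _).symm)
    (orientation_map_map ((glEquiv (B : GL (Fin (n + 2)) ℝ)).submoduleMap P.carrier)
      ((glEquiv (A : GL (Fin (n + 2)) ℝ)).submoduleMap (map B P).carrier) P.orientation).symm

end LorentzPlane

/-! ### Oriented spheres -/

/-- An oriented `q`-sphere `Σ` in the unit sphere `Sⁿ` of `ℝ^{n+1}`: the points of a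
`(q + 1)`-dimensional affine subspace at distance `r > 0` from one of its points `c`, all lying on
`Sⁿ`, together with an orientation of the direction of the affine hull of `Σ`, which amounts to an
orientation of the ball bounded by `Σ`. For `q ≥ 1` this is an orientation of the manifold `Σ` as
the boundary of that ball; for `q = 0` it is an ordering of the two points of `Σ`. -/
structure OrientedSphere (q n : ℕ) where
  carrier : Set (EuclideanSpace ℝ (Fin (n + 1)))
  subset_sphere : carrier ⊆ Metric.sphere 0 1
  isRoundSphere : ∃ (E : AffineSubspace ℝ (EuclideanSpace ℝ (Fin (n + 1))))
    (c : EuclideanSpace ℝ (Fin (n + 1))) (r : ℝ),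
    finrank ℝ E.direction = q + 1 ∧ c ∈ E ∧ 0 < r ∧ carrier = (E : Set _) ∩ Metric.sphere c r
  orientation : Orientation ℝ (vectorSpan ℝ carrier) (Fin (q + 1))

/-- The lightlike vector `(1, x)` representing the point `x` of `Sⁿ`. -/
def lightVector {n : ℕ} (x : EuclideanSpace ℝ (Fin (n + 1))) : Fin (n + 2) → ℝ :=
  Fin.cons 1 x.ofLp

/-- The linear inclusion `v ↦ (0, v)`. -/
def spaceVector (n : ℕ) : EuclideanSpace ℝ (Fin (n + 1)) →ₗ[ℝ] (Fin (n + 2) → ℝ) where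
  toFun v := Fin.cons 0 v.ofLp
  map_add' v w := by
    funext i
    refine Fin.cases ?_ (fun i => ?_) i <;> simp
  map_smul' a v := by
    funext i
    refine Fin.cases ?_ (fun i => ?_) i <;> simp

theorem spaceVector_injective (n : ℕ) : Function.Injective (spaceVector n) := by
  intro v w h
  ext i
  have := congrFun h i.succ
  simpa [spaceVector] using this

theorem lightVector_sub {n : ℕ} (x y : EuclideanSpace ℝ (Fin (n + 1))) :
    lightVector x - lightVector y = spaceVector n (x - y) := by
  funext i
  refine Fin.cases ?_ (fun i => ?_) i <;> simp [lightVector, spaceVector]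

theorem minkowskiForm_lightVector {n : ℕ} (x y : EuclideanSpace ℝ (Fin (n + 1))) :
    minkowskiForm (n + 2) (lightVector x) (lightVector y) = -1 + inner ℝ x y := by
  simp [minkowskiForm_apply, lightVector, PiLp.inner_apply, mul_comm]

namespace OrientedSphere

variable {q n : ℕ} (S : OrientedSphere q n)

theorem exists_pair : ∃ x ∈ S.carrier, ∃ y ∈ S.carrier, x ≠ y := by
  obtain ⟨E, c, r, hE, hc, hr, hS⟩ := S.isRoundSphere
  have : Nontrivial E.direction := nontrivial_of_finrank_pos (R := ℝ) (by omega)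
  obtain ⟨⟨u, hu⟩, hne⟩ := exists_ne (0 : E.direction)
  have hu0 : u ≠ 0 := fun h => hne (Subtype.ext h)
  have hn : 0 < ‖u‖ := norm_pos_iff.2 hu0
  have mem : ∀ t : ℝ, |t| * ‖u‖ = r → t • u +ᵥ c ∈ S.carrier := by
    intro t ht
    rw [hS]
    refine ⟨AffineSubspace.vadd_mem_of_mem_direction (E.direction.smul_mem t hu) hc, ?_⟩
    simp [norm_smul, ht]
  refine ⟨_, mem (r / ‖u‖) ?_, _, mem (-(r / ‖u‖)) ?_, ?_⟩
  · rw [abs_of_pos (by positivity)]; field_simp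
  · rw [abs_neg, abs_of_pos (by positivity)]; field_simp
  · intro h
    have h1 : (r / ‖u‖) • u = (-(r / ‖u‖)) • u := vadd_right_cancel _ h
    have h2 : (r / ‖u‖) = -(r / ‖u‖) := smul_left_injective ℝ hu0 h1
    have : 0 < r / ‖u‖ := by positivity
    linarith

theorem finrank_vectorSpan : finrank ℝ (vectorSpan ℝ S.carrier) = q + 1 := by
  obtain ⟨E, c, r, hE, hc, hr, hS⟩ := S.isRoundSphere
  suffices h : vectorSpan ℝ S.carrier = E.direction by rw [h, hE]
  apply le_antisymm
  · rw [AffineSubspace.direction_eq_vectorSpan]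
    exact vectorSpan_mono ℝ (hS ▸ Set.inter_subset_left)
  · intro u hu
    by_cases hu0 : u = 0
    · rw [hu0]; exact zero_mem _
    have hn : 0 < ‖u‖ := norm_pos_iff.2 hu0
    have mem : ∀ t : ℝ, |t| * ‖u‖ = r → t • u +ᵥ c ∈ S.carrier := by
      intro t ht
      rw [hS]
      refine ⟨AffineSubspace.vadd_mem_of_mem_direction (E.direction.smul_mem t hu) hc, ?_⟩
      simp [norm_smul, ht]
    have h1 := mem (r / ‖u‖) (by rw [abs_of_pos (by positivity)]; field_simp)
    have h2 := mem (-(r / ‖u‖)) (by rw [abs_neg, abs_of_pos (by positivity)]; field_simp)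
    have h3 := vsub_mem_vectorSpan ℝ h1 h2
    rw [vadd_vsub_vadd_cancel_right, ← sub_smul] at h3
    have h4 := Submodule.smul_mem _ (r / ‖u‖ - -(r / ‖u‖))⁻¹ h3
    rwa [smul_smul, inv_mul_cancel₀, one_smul] at h4
    have : 0 < r / ‖u‖ := by positivity
    linarith

/-- The linear span `Π_Σ` of `Σ` in Minkowski space. -/
def cone : Submodule ℝ (Fin (n + 2) → ℝ) :=
  Submodule.span ℝ (lightVector '' S.carrier)

theorem lightVector_mem {x : EuclideanSpace ℝ (Fin (n + 1))} (hx : x ∈ S.carrier) :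
    lightVector x ∈ S.cone := Submodule.subset_span ⟨x, hx, rfl⟩

theorem spaceVector_mem {v : EuclideanSpace ℝ (Fin (n + 1))} (hv : v ∈ vectorSpan ℝ S.carrier) :
    spaceVector n v ∈ S.cone := by
  have : vectorSpan ℝ S.carrier ≤ S.cone.comap (spaceVector n) := by
    rw [vectorSpan_def, Submodule.span_le]
    rintro _ ⟨x, hx, y, hy, rfl⟩
    change spaceVector n (x - y) ∈ S.cone
    rw [← lightVector_sub]
    exact S.cone.sub_mem (S.lightVector_mem hx) (S.lightVector_mem hy)
  exact this hv

/-- The vectors `(1, x), (0, b₀), …, (0, b_q)` of `Π_Σ`, where `x ∈ Σ` and `b` is a basis of the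
direction of the affine hull of `Σ`. -/
def frame (x : S.carrier) (b : Basis (Fin (q + 1)) ℝ (vectorSpan ℝ S.carrier)) :
    Fin (q + 2) → S.cone :=
  Fin.cons ⟨lightVector x, S.lightVector_mem x.2⟩
    fun i => ⟨spaceVector n (b i), S.spaceVector_mem (b i).2⟩

theorem coe_frame (x : S.carrier) (b : Basis (Fin (q + 1)) ℝ (vectorSpan ℝ S.carrier)) :
    (fun i => (S.frame x b i : Fin (n + 2) → ℝ)) =
      Fin.cons (lightVector (x : EuclideanSpace ℝ (Fin (n + 1))))
        fun i => spaceVector n (b i : EuclideanSpace ℝ (Fin (n + 1))) := by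
  funext i
  refine Fin.cases ?_ (fun i => ?_) i <;> simp [frame]

theorem linearIndependent_frame (x : S.carrier)
    (b : Basis (Fin (q + 1)) ℝ (vectorSpan ℝ S.carrier)) :
    LinearIndependent ℝ (S.frame x b) := by
  apply LinearIndependent.of_comp S.cone.subtype
  change LinearIndependent ℝ (fun i => (S.frame x b i : Fin (n + 2) → ℝ))
  rw [coe_frame, linearIndependent_finCons]
  constructor
  · have h1 := b.linearIndependent.map' (vectorSpan ℝ S.carrier).subtype (Submodule.ker_subtype _)
    exact h1.map' (spaceVector n) (LinearMap.ker_eq_bot.2 (spaceVector_injective n))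
  · intro h
    have hle : Submodule.span ℝ (Set.range fun i => spaceVector n
        (b i : EuclideanSpace ℝ (Fin (n + 1)))) ≤
        LinearMap.ker (LinearMap.proj (R := ℝ) (φ := fun _ : Fin (n + 2) => ℝ) 0) := by
      rw [Submodule.span_le]
      rintro _ ⟨i, rfl⟩
      simp [spaceVector]
    have := hle h
    simp [lightVector] at this

theorem span_frame (x : S.carrier) (b : Basis (Fin (q + 1)) ℝ (vectorSpan ℝ S.carrier)) :
    ⊤ ≤ Submodule.span ℝ (Set.range (S.frame x b)) := by
  set T := Submodule.span ℝ (Set.range (S.frame x b)) with hT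
  have hx : lightVector (x : EuclideanSpace ℝ (Fin (n + 1))) ∈ T.map S.cone.subtype :=
    ⟨S.frame x b 0, Submodule.subset_span ⟨0, rfl⟩, rfl⟩
  have hb : ∀ v ∈ vectorSpan ℝ S.carrier, spaceVector n v ∈ T.map S.cone.subtype := by
    intro v hv
    have h := b.sum_repr ⟨v, hv⟩
    have h' : v = ∑ i, b.repr ⟨v, hv⟩ i • (b i : EuclideanSpace ℝ (Fin (n + 1))) := by
      have h2 := congrArg (vectorSpan ℝ S.carrier).subtype h
      rw [map_sum] at h2
      exact h2.symm
    rw [h', map_sum]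
    refine Submodule.sum_mem _ fun i _ => ?_
    rw [map_smul]
    exact Submodule.smul_mem _ _ ⟨S.frame x b i.succ, Submodule.subset_span ⟨i.succ, rfl⟩, rfl⟩
  have hle : S.cone ≤ T.map S.cone.subtype := by
    refine Submodule.span_le.2 ?_
    rintro _ ⟨y, hy, rfl⟩
    have h1 : lightVector y = lightVector (x : EuclideanSpace ℝ (Fin (n + 1))) +
        spaceVector n (y - x) := by
      rw [← lightVector_sub]; abel
    rw [h1]
    exact Submodule.add_mem _ hx (hb _ (vsub_mem_vectorSpan ℝ hy x.2))
  rintro ⟨w, hw⟩ -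
  obtain ⟨w', hw', rfl⟩ := hle hw
  exact hw'

/-- The basis `(1, x), (0, b₀), …, (0, b_q)` of `Π_Σ`. -/
def frameBasis (x : S.carrier) (b : Basis (Fin (q + 1)) ℝ (vectorSpan ℝ S.carrier)) :
    Basis (Fin (q + 2)) ℝ S.cone :=
  Basis.mk (S.linearIndependent_frame x b) (S.span_frame x b)

/-- A point of `Σ`. -/
def somePoint : S.carrier := ⟨S.exists_pair.choose, S.exists_pair.choose_spec.1⟩

/-- A basis of the direction of the affine hull of `Σ` that gives the orientation. -/
def someBasis : Basis (Fin (q + 1)) ℝ (vectorSpan ℝ S.carrier) :=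
  S.orientation.someBasis (by rw [S.finrank_vectorSpan, Fintype.card_fin])

theorem exists_timelike : ∃ v ∈ S.cone, minkowskiForm (n + 2) v v < 0 := by
  obtain ⟨x, hx, y, hy, hxy⟩ := S.exists_pair
  refine ⟨lightVector x + lightVector y,
    S.cone.add_mem (S.lightVector_mem hx) (S.lightVector_mem hy), ?_⟩
  have hx1 : ‖x‖ = 1 := by simpa using S.subset_sphere hx
  have hy1 : ‖y‖ = 1 := by simpa using S.subset_sphere hy
  have h := (inner_lt_one_iff_real_of_norm_eq_one hx1 hy1).2 hxy
  simp only [map_add, LinearMap.add_apply, minkowskiForm_lightVector, real_inner_self_eq_norm_sq,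
    hx1, hy1, real_inner_comm]
  rw [real_inner_comm] at h
  linarith [real_inner_comm x y]

/-- The oriented plane `Π_Σ` spanned by an oriented sphere `Σ`, so that `Σ` is the intersection of
`Sⁿ` and `Π_Σ`. Its orientation is given by `(1, x), (0, b₀), …, (0, b_q)`, for any `x ∈ Σ` and any
basis `b` that gives the orientation of `Σ`. -/
def toPlane : LorentzPlane q n where
  carrier := S.cone
  finrank_carrier := by
    rw [finrank_eq_card_basis (S.frameBasis S.somePoint S.someBasis), Fintype.card_fin]
  nondegenerate := by
    obtain ⟨v, hv, hneg⟩ := S.exists_timelike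
    exact nondegenerate_of_timelike hv hneg
  index_eq_one := by
    obtain ⟨v, hv, hneg⟩ := S.exists_timelike
    exact sigNeg_of_timelike hv hneg
  orientation := (S.frameBasis S.somePoint S.someBasis).orientation

end OrientedSphere

/-! ### Plücker coordinates -/

/-- The space `ℝᴺ`, `N = (n+2 choose q+2)`, of vectors of Plücker coordinates `p_I`, indexed by
`I = (i₁ < ⋯ < i_{q+2})`; it is the exterior power `⋀^{q+2} ℝ^{n+2}`. -/
abbrev PluckerSpace (q n : ℕ) : Type := (Fin (q + 2) ↪o Fin (n + 2)) → ℝ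

/-- The coordinates of `x₁ ∧ ⋯ ∧ x_{q+2}`. -/
def wedge {q n : ℕ} (x : Fin (q + 2) → Fin (n + 2) → ℝ) : PluckerSpace q n :=
  fun I => (Matrix.of fun i k => x i (I k)).det

/-- The form on `⋀^{q+2} ℝ^{n+2}` induced by the Minkowski form:
`⟨e_I, e_J⟩ = - det (⟨e_{i_k}, e_{j_l}⟩)`, which for `I = J` is `1` if `i₁ = 0` and `-1` if
`i₁ ≥ 1`, and vanishes for `I ≠ J`. -/
def pluckerForm (q n : ℕ) : LinearMap.BilinForm ℝ (PluckerSpace q n) :=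
  Matrix.toBilin' (Matrix.of fun I J => -((minkowskiMatrix (n + 2)).submatrix I J).det)

/-- The unit multiple of `x₁ ∧ ⋯ ∧ x_{q+2}`, for a basis `x` that gives the orientation of `Π`. -/
def LorentzPlane.plucker {q n : ℕ} (P : LorentzPlane q n) : PluckerSpace q n :=
  let x : Fin (q + 2) → Fin (n + 2) → ℝ := fun i =>
    P.orientation.someBasis (by rw [P.finrank_carrier, Fintype.card_fin]) i
  (√(pluckerForm q n (wedge x) (wedge x)))⁻¹ • wedge x

/-- The normalized Plücker vector of an oriented sphere. -/
def OrientedSphere.plucker {q n : ℕ} (S : OrientedSphere q n) : PluckerSpace q n :=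
  S.toPlane.plucker

/-! ### The isotropy group -/

/-- The homomorphism `SO(n - q) × SO(q + 1, 1) → GL(n + 2)` that sends `(C, B)` to the block
diagonal matrix `diag(B, C)`. -/
def blockHom {q n : ℕ} (h : q ≤ n) :
    Matrix.specialOrthogonalGroup (Fin (n - q)) ℝ × SOLorentz (q + 2) →* GL (Fin (n + 2)) ℝ :=
  MonoidHom.toHomUnits
    { toFun := fun p => (Matrix.fromBlocks ((p.2 : GL (Fin (q + 2)) ℝ) : Matrix _ _ ℝ) 0 0
          (p.1 : Matrix _ _ ℝ)).submatrix
          (finSumFinEquiv.trans (finCongr (show q + 2 + (n - q) = n + 2 by omega))).symm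
          (finSumFinEquiv.trans (finCongr (show q + 2 + (n - q) = n + 2 by omega))).symm
      map_one' := by
        change (Matrix.fromBlocks 1 0 0 1).submatrix _ _ = _
        rw [Matrix.fromBlocks_one, Matrix.submatrix_one_equiv]
      map_mul' := fun p p' => by
        rw [Matrix.submatrix_mul_equiv, Matrix.fromBlocks_multiply]
        simp }

theorem minkowskiMatrix_eq_blocks {q n : ℕ} (h : q ≤ n) :
    minkowskiMatrix (n + 2) = (Matrix.fromBlocks (minkowskiMatrix (q + 2)) 0 0
      (1 : Matrix (Fin (n - q)) (Fin (n - q)) ℝ)).submatrix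
        (finSumFinEquiv.trans (finCongr (show q + 2 + (n - q) = n + 2 by omega))).symm
        (finSumFinEquiv.trans (finCongr (show q + 2 + (n - q) = n + 2 by omega))).symm := by
  rw [← Matrix.diagonal_one, minkowskiMatrix, minkowskiMatrix, Matrix.fromBlocks_diagonal,
    Matrix.submatrix_diagonal_equiv]
  congr 1
  funext i
  obtain ⟨j, rfl⟩ :=
    (finSumFinEquiv.trans (finCongr (show q + 2 + (n - q) = n + 2 by omega))).surjective i
  rcases j with j | j <;> simp

theorem blockHom_mem {q n : ℕ} (h : q ≤ n)
    (p : Matrix.specialOrthogonalGroup (Fin (n - q)) ℝ × SOLorentz (q + 2)) :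
    blockHom h p ∈ SOLorentz (n + 2) := by
  obtain ⟨⟨C, hC⟩, ⟨B, hB, hB'⟩⟩ := p
  have hC' := Matrix.mem_specialOrthogonalGroup_iff.1 hC
  have hCC : Cᵀ * C = 1 := by
    simpa [Matrix.star_eq_conjTranspose] using (Matrix.mem_orthogonalGroup_iff' _ _).1 hC'.1
  have hcoe : ((blockHom h (⟨C, hC⟩, ⟨B, hB, hB'⟩) : GL (Fin (n + 2)) ℝ) : Matrix _ _ ℝ) =
      (Matrix.fromBlocks (B : Matrix _ _ ℝ) 0 0 C).submatrix
        (finSumFinEquiv.trans (finCongr (show q + 2 + (n - q) = n + 2 by omega))).symm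
        (finSumFinEquiv.trans (finCongr (show q + 2 + (n - q) = n + 2 by omega))).symm := rfl
  refine ⟨?_, ?_⟩
  · rw [hcoe, minkowskiMatrix_eq_blocks h, Matrix.transpose_submatrix, Matrix.submatrix_mul_equiv,
      Matrix.submatrix_mul_equiv, Matrix.fromBlocks_transpose, Matrix.fromBlocks_multiply,
      Matrix.fromBlocks_multiply]
    simp [hB, hCC]
  · rw [hcoe, Matrix.det_submatrix_equiv_self, Matrix.det_fromBlocks_zero₂₁, hB', hC'.2, one_mul]

/-- The subgroup `SO(n - q) × SO(q + 1, 1)` of `SO(n + 1, 1)`. -/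
def isotropyGroup {q n : ℕ} (h : q ≤ n) : Subgroup (SOLorentz (n + 2)) :=
  ((blockHom h).codRestrict (SOLorentz (n + 2)) (blockHom_mem h)).range

/-! ### Smooth actions and pseudo-Riemannian metrics -/

section

variable {E H : Type*} [NormedAddCommGroup E] [NormedSpace ℝ E] [TopologicalSpace H]
  (I : ModelWithCorners ℝ E H) (M : Type*) [TopologicalSpace M] [ChartedSpace H M]

/-- An action of a matrix group `G` on `M` is smooth: `A(t) • p(t)` depends smoothly on
`t ∈ ℝᵏ` whenever `A(t) ∈ G` and `p(t) ∈ M` do. -/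
def IsSmoothMatrixAction {m : ℕ} (G : Subgroup (GL (Fin m) ℝ)) [MulAction G M] : Prop :=
  ∀ (k : ℕ) (A : EuclideanSpace ℝ (Fin k) → G) (p : EuclideanSpace ℝ (Fin k) → M),
    (∀ i j, ContDiff ℝ ∞ fun t => ((A t : GL (Fin m) ℝ) : Matrix (Fin m) (Fin m) ℝ) i j) →
    ContMDiff (𝓡 k) I ∞ p → ContMDiff (𝓡 k) I ∞ fun t => A t • p t

/-- A smooth pseudo-Riemannian metric: a smooth section of the bundle of bilinear forms on the
tangent spaces that is symmetric and non-degenerate at every point. -/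
structure PseudoRiemannianMetric [IsManifold I ∞ M] where
  val (p : M) : TangentSpace I p →L[ℝ] TangentSpace I p →L[ℝ] ℝ
  symm (p : M) (u v : TangentSpace I p) : val p u v = val p v u
  nondegenerate (p : M) (u : TangentSpace I p) : (∀ v, val p u v = 0) → u = 0
  contMDiff : ContMDiff I (I.prod 𝓘(ℝ, E →L[ℝ] E →L[ℝ] ℝ)) ∞
    (fun p => Bundle.TotalSpace.mk' (E →L[ℝ] E →L[ℝ] ℝ)
      (E := fun p : M => TangentSpace I p →L[ℝ] TangentSpace I p →L[ℝ] ℝ) p (val p))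

end

end SphereSpace

end

/-!
A sphere `Σ` is recovered from `Π_Σ` as its intersection with the affine slice `x₀ = 1` of the light
cone, which is a round sphere exactly when `Π_Σ` has index one. Oriented planes are in turn
determined by their normalized Plücker vectors.

The planes that are graphs over the coordinate plane of `e₀, …, e_{q+1}` are spanned by the rows of
`(1 | X)`, with `X` a `(q + 2) × (n - q)` matrix. The entries of `X` are coordinates of the wedge of
these rows, so `X` can be read off from the Plücker vector. This gives a chart in which `ψ` is the
graph of a smooth map after rescaling, and its translates under the transitive action of
`SO(n + 1, 1)` form an atlas. The stabilizer of the coordinate plane consists of block triangular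
matrices, and a block triangular isometry is block diagonal.

Translation by an isometry reduces the metric to the origin of the chart. There the Plücker form of
the wedges of `(1 | X)` and `(1 | Y)` is `det (1 + ε X Yᵀ)` with `ε = diag (-1, 1, …, 1)`. Its
mixed second derivative at the origin is `tr (ε X Yᵀ)`, which is negative definite on the first row
and positive definite on the other `q + 1` rows.
-/

noncomputable section

namespace SphereSpace

/-! ### Spheres correspond to planes -/

section RoundSphere

variable {V : Type*} [NormedAddCommGroup V] [NormedSpace ℝ V]

theorem le_of_forall_mem_of_norm_eq {K L : Submodule ℝ V} {r : ℝ} (hr : 0 < r)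
    (h : ∀ u ∈ K, ‖u‖ = r → u ∈ L) : K ≤ L := by
  intro u hu
  obtain rfl | hu0 := eq_or_ne u 0
  · exact L.zero_mem
  have hscale : r * ‖u‖⁻¹ ≠ 0 := mul_ne_zero hr.ne' (inv_ne_zero (norm_ne_zero_iff.2 hu0))
  exact (L.smul_mem_iff hscale).1
    (h _ (K.smul_mem _ hu) (norm_smul_inv_norm' (𝕜 := ℝ) hr.le hu0))

theorem add_mem_inter_sphere {E : AffineSubspace ℝ V} {c u : V} {r : ℝ} (hc : c ∈ E)
    (hu : u ∈ E.direction) (hur : ‖u‖ = r) : c + u ∈ (E : Set V) ∩ Metric.sphere c r :=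
  ⟨add_comm u c ▸ AffineSubspace.vadd_mem_of_mem_direction hu hc, by simp [hur]⟩

theorem vectorSpan_inter_sphere {E : AffineSubspace ℝ V} {c : V} {r : ℝ} (hc : c ∈ E)
    (hr : 0 < r) : vectorSpan ℝ ((E : Set V) ∩ Metric.sphere c r) = E.direction := by
  refine le_antisymm (E.direction_eq_vectorSpan ▸ vectorSpan_mono ℝ Set.inter_subset_left)
    (le_of_forall_mem_of_norm_eq hr fun u hu hur => ?_)
  have hdiff : (2 : ℝ) • u ∈ vectorSpan ℝ ((E : Set V) ∩ Metric.sphere c r) := by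
    have := vsub_mem_vectorSpan ℝ (add_mem_inter_sphere hc hu hur)
      (add_mem_inter_sphere hc (neg_mem hu) (by rwa [norm_neg]))
    rwa [vsub_eq_sub, add_sub_add_left_eq_sub, sub_neg_eq_add, ← two_smul ℝ u] at this
  exact (Submodule.smul_mem_iff _ two_ne_zero).1 hdiff

theorem affineSpan_inter_sphere {E : AffineSubspace ℝ V} {c : V} {r : ℝ} (hc : c ∈ E)
    (hr : 0 < r) (hE : E.direction ≠ ⊥) :
    affineSpan ℝ ((E : Set V) ∩ Metric.sphere c r) = E := by
  obtain ⟨u, hu, hu0⟩ := Submodule.exists_mem_ne_zero_of_ne_bot hE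
  have hmem := add_mem_inter_sphere hc (E.direction.smul_mem (r * ‖u‖⁻¹) hu)
    (norm_smul_inv_norm' (𝕜 := ℝ) hr.le hu0)
  refine AffineSubspace.eq_of_direction_eq_of_nonempty_of_le ?_ ⟨_, mem_affineSpan ℝ hmem⟩
    (affineSpan_le.2 Set.inter_subset_left)
  rw [direction_affineSpan, vectorSpan_inter_sphere hc hr]

end RoundSphere

section Pythagoras

variable {V : Type*} [NormedAddCommGroup V] [InnerProductSpace ℝ V] {E : AffineSubspace ℝ V}
  {c : V} {r R : ℝ}

theorem inter_sphere_eq_inter_sphere_zero (hc : c ∈ E)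
    (horth : ∀ u ∈ E.direction, inner ℝ c u = 0) (hr : 0 ≤ r) (hR : 0 ≤ R)
    (hcR : ‖c‖ ^ 2 + r ^ 2 = R ^ 2) :
    (E : Set V) ∩ Metric.sphere c r = (E : Set V) ∩ Metric.sphere 0 R := by
  ext x
  refine and_congr_right fun hx => ?_
  have hpyth : ‖x‖ ^ 2 = ‖c‖ ^ 2 + ‖x - c‖ ^ 2 := by
    have hxc : x - c ∈ E.direction := AffineSubspace.vsub_mem_direction hx hc
    have := norm_add_sq_real c (x - c)
    rwa [horth _ hxc, add_sub_cancel, mul_zero, add_zero] at this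
  rw [mem_sphere_iff_norm, mem_sphere_zero_iff_norm, ← sq_eq_sq₀ (norm_nonneg _) hr,
    ← sq_eq_sq₀ (norm_nonneg _) hR]
  constructor <;> intro h <;> linarith

theorem inner_eq_zero_and_norm_sq_add_of_inter_sphere_subset (hc : c ∈ E)
    (hsub : (E : Set V) ∩ Metric.sphere c r ⊆ Metric.sphere 0 R) {u : V}
    (hu : u ∈ E.direction) (hur : ‖u‖ = r) : inner ℝ c u = 0 ∧ ‖c‖ ^ 2 + r ^ 2 = R ^ 2 := by
  have hadd : ‖c + u‖ = R := by simpa using hsub (add_mem_inter_sphere hc hu hur)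
  have hsubt : ‖c - u‖ = R := by
    simpa [sub_eq_add_neg] using
      hsub (add_mem_inter_sphere hc (neg_mem hu) (by rwa [norm_neg]))
  have e₁ := norm_add_sq_real c u
  have e₂ := norm_sub_sq_real c u
  rw [hadd, hur] at e₁
  rw [hsubt, hur] at e₂
  constructor <;> linarith

theorem inter_sphere_eq_affineSpan_inter_sphere_zero (hc : c ∈ E) (hr : 0 < r) (hR : 0 ≤ R)
    (hE : E.direction ≠ ⊥) (hsub : (E : Set V) ∩ Metric.sphere c r ⊆ Metric.sphere 0 R) :
    (E : Set V) ∩ Metric.sphere c r =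
      (affineSpan ℝ ((E : Set V) ∩ Metric.sphere c r) : Set V) ∩ Metric.sphere 0 R := by
  have horth : E.direction ≤ (ℝ ∙ c)ᗮ := le_of_forall_mem_of_norm_eq hr fun u hu hur =>
    Submodule.mem_orthogonal_singleton_iff_inner_right.2
      (inner_eq_zero_and_norm_sq_add_of_inter_sphere_subset hc hsub hu hur).1
  obtain ⟨u, hu, hu0⟩ := Submodule.exists_mem_ne_zero_of_ne_bot hE
  have hcR := (inner_eq_zero_and_norm_sq_add_of_inter_sphere_subset hc hsub
    (E.direction.smul_mem (r * ‖u‖⁻¹) hu) (norm_smul_inv_norm' (𝕜 := ℝ) hr.le hu0)).2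
  rw [affineSpan_inter_sphere hc hr hE]
  exact inter_sphere_eq_inter_sphere_zero hc
    (fun u hu => Submodule.mem_orthogonal_singleton_iff_inner_right.1 (horth hu)) hr.le hR hcR

end Pythagoras

theorem lightVector_add {n : ℕ} (x v : EuclideanSpace ℝ (Fin (n + 1))) :
    lightVector (x + v) = lightVector x + spaceVector n v := by
  rw [← sub_eq_iff_eq_add', lightVector_sub, add_sub_cancel_left]

theorem lightVector_mem_span_image_iff {n : ℕ} {s : Set (EuclideanSpace ℝ (Fin (n + 1)))}
    {p : EuclideanSpace ℝ (Fin (n + 1))} (hp : p ∈ s) {x : EuclideanSpace ℝ (Fin (n + 1))} :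
    lightVector x ∈ Submodule.span ℝ (lightVector '' s) ↔ x ∈ affineSpan ℝ s := by
  have hdir : x ∈ affineSpan ℝ s ↔ x - p ∈ vectorSpan ℝ s := by
    rw [← direction_affineSpan, ← vsub_eq_sub,
      AffineSubspace.vsub_right_mem_direction_iff_mem (mem_affineSpan ℝ hp)]
  have hspan : Submodule.span ℝ (lightVector '' s) =
      ℝ ∙ lightVector p ⊔ (vectorSpan ℝ s).map (spaceVector n) := by
    apply le_antisymm
    · rw [Submodule.span_le]
      rintro _ ⟨y, hy, rfl⟩
      rw [← add_sub_cancel p y, lightVector_add]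
      exact Submodule.add_mem_sup (Submodule.mem_span_singleton_self _)
        (Submodule.mem_map_of_mem (vsub_mem_vectorSpan ℝ hy hp))
    · rw [sup_le_iff, Submodule.span_singleton_le_iff_mem, Submodule.map_le_iff_le_comap,
        vectorSpan_def, Submodule.span_le]
      refine ⟨Submodule.subset_span ⟨p, hp, rfl⟩, ?_⟩
      rintro _ ⟨y, hy, z, hz, rfl⟩
      change spaceVector n (y - z) ∈ Submodule.span ℝ (lightVector '' s)
      rw [← lightVector_sub]
      exact sub_mem (Submodule.subset_span ⟨y, hy, rfl⟩) (Submodule.subset_span ⟨z, hz, rfl⟩)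
  rw [hdir, hspan, Submodule.mem_sup]
  constructor
  · rintro ⟨_, ht, _, ⟨v, hv, rfl⟩, h⟩
    obtain ⟨t, rfl⟩ := Submodule.mem_span_singleton.1 ht
    obtain rfl : t = 1 := by simpa [lightVector, spaceVector] using congrFun h 0
    rw [one_smul, ← eq_sub_iff_add_eq', lightVector_sub] at h
    exact spaceVector_injective n h ▸ hv
  · intro h
    exact ⟨_, Submodule.mem_span_singleton_self _, _, Submodule.mem_map_of_mem h,
      by rw [← lightVector_add, add_sub_cancel]⟩

theorem exists_eq_smul_lightVector {n : ℕ} {w : Fin (n + 2) → ℝ} (hw : w 0 ≠ 0) :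
    ∃ x : EuclideanSpace ℝ (Fin (n + 1)), w = w 0 • lightVector x := by
  refine ⟨WithLp.toLp 2 fun i => (w 0)⁻¹ * w i.succ, funext fun i => ?_⟩
  refine Fin.cases ?_ (fun i => ?_) i <;> simp [lightVector, hw]

/-- The directions of space contained in a subspace `W` of Minkowski space: the vectors `v` with
`(0, v) ∈ W`. -/
def spacePart {n : ℕ} (W : Submodule ℝ (Fin (n + 2) → ℝ)) :
    Submodule ℝ (EuclideanSpace ℝ (Fin (n + 1))) :=
  W.comap (spaceVector n)

section SpacePart

variable {n : ℕ} {W : Submodule ℝ (Fin (n + 2) → ℝ)}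

theorem range_spaceVector (n : ℕ) :
    LinearMap.range (spaceVector n) =
      LinearMap.ker (LinearMap.proj (R := ℝ) (0 : Fin (n + 2))) := by
  ext w
  constructor
  · rintro ⟨v, rfl⟩
    rfl
  · intro hw
    refine ⟨WithLp.toLp 2 fun i => w i.succ, funext fun i => ?_⟩
    refine Fin.cases ?_ (fun i => ?_) i
    · exact (LinearMap.mem_ker.1 hw).symm
    · rfl

theorem finrank_spacePart_add_one {x : EuclideanSpace ℝ (Fin (n + 1))} (hx : lightVector x ∈ W) :
    finrank ℝ (spacePart W) + 1 = finrank ℝ W := by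
  let time : Dual ℝ W := (LinearMap.proj (0 : Fin (n + 2))).domRestrict W
  have htime : time ≠ 0 := fun h => one_ne_zero (LinearMap.congr_fun h ⟨_, hx⟩)
  have hker : (spacePart W).map (spaceVector n) = (LinearMap.ker time).map W.subtype := by
    rw [LinearMap.ker_domRestrict, Submodule.map_comap_subtype, spacePart, Submodule.map_comap_eq,
      range_spaceVector, inf_comm]
  rw [← Dual.finrank_ker_add_one_of_ne_zero htime, ← Submodule.finrank_map_subtype_eq, ← hker,
    ((spacePart W).equivMapOfInjective _ (spaceVector_injective n)).finrank_eq]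

theorem exists_lightVector_mem_norm_lt_one {w : Fin (n + 2) → ℝ} (hw : w ∈ W)
    (hneg : minkowskiForm (n + 2) w w < 0) :
    ∃ x : EuclideanSpace ℝ (Fin (n + 1)), lightVector x ∈ W ∧ ‖x‖ < 1 := by
  have hw0 : w 0 ≠ 0 := by
    intro h
    rw [minkowskiForm_apply, h, mul_zero, neg_zero, zero_add] at hneg
    exact hneg.not_ge (Finset.sum_nonneg fun i _ => mul_self_nonneg _)
  obtain ⟨x, hx⟩ := exists_eq_smul_lightVector hw0
  refine ⟨x, (W.smul_mem_iff hw0).1 (hx ▸ hw), ?_⟩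
  rw [hx, map_smul, map_smul, LinearMap.smul_apply, minkowskiForm_lightVector,
    real_inner_self_eq_norm_sq, smul_eq_mul, smul_eq_mul, ← mul_assoc] at hneg
  have := neg_of_mul_neg_right hneg (mul_self_nonneg (w 0))
  exact (sq_lt_one_iff₀ (norm_nonneg x)).1 (by linarith)

theorem exists_center {x : EuclideanSpace ℝ (Fin (n + 1))} (hx : lightVector x ∈ W) :
    ∃ c : EuclideanSpace ℝ (Fin (n + 1)),
      lightVector c ∈ W ∧ ‖c‖ ≤ ‖x‖ ∧ ∀ v ∈ spacePart W, inner ℝ c v = 0 := by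
  refine ⟨x - (spacePart W).starProjection x, ?_, ?_,
    fun v hv => Submodule.starProjection_inner_eq_zero x v hv⟩
  · rw [sub_eq_add_neg, lightVector_add]
    exact W.add_mem hx ((spacePart W).neg_mem ((spacePart W).starProjection_apply_mem x))
  · have hpyth := norm_add_sq_real (x - (spacePart W).starProjection x)
      ((spacePart W).starProjection x)
    rw [sub_add_cancel, Submodule.starProjection_inner_eq_zero x _
      ((spacePart W).starProjection_apply_mem x)] at hpyth
    rw [← sq_le_sq₀ (norm_nonneg _) (norm_nonneg _)]
    linarith [sq_nonneg ‖(spacePart W).starProjection x‖]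

end SpacePart

namespace LorentzPlane

variable {q n : ℕ}

theorem exists_timelike (P : LorentzPlane q n) :
    ∃ v ∈ P.carrier, minkowskiForm (n + 2) v v < 0 := by
  obtain ⟨U, hU, hneg⟩ := exists_finrank_eq_sigNeg_and_negDef (restrictedForm P.carrier)
  rw [P.index_eq_one] at hU
  have : Nontrivial U := nontrivial_of_finrank_pos (R := ℝ) (by omega)
  obtain ⟨u, hu⟩ := exists_ne (0 : U)
  exact ⟨u, (u : P.carrier).2, neg_pos.1 (hneg u hu)⟩

theorem eq_or_eq_of_carrier_eq {P Q R : LorentzPlane q n} (hPQ : P ≠ Q)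
    (hP : P.carrier = R.carrier) (hQ : Q.carrier = R.carrier) : P = R ∨ Q = R := by
  obtain ⟨W, hW, _, _, o⟩ := R
  obtain ⟨_, _, _, _, o₁⟩ := P
  obtain ⟨_, _, _, _, o₂⟩ := Q
  obtain rfl : _ = W := hP
  obtain rfl : _ = _ := hQ
  simp only [ne_eq, mk.injEq, heq_eq_eq, true_and] at hPQ ⊢
  have hcard : Fintype.card (Fin (q + 2)) = finrank ℝ _ := (Fintype.card_fin _).trans hW.symm
  rcases o₁.eq_or_eq_neg o hcard with h₁ | h₁
  · exact .inl h₁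
  · exact .inr ((o₂.eq_or_eq_neg o hcard).resolve_right fun h₂ => hPQ (h₁.trans h₂.symm))

end LorentzPlane

namespace OrientedSphere

variable {q n : ℕ}

theorem carrier_eq (S : OrientedSphere q n) :
    S.carrier = {x | lightVector x ∈ S.cone} ∩ Metric.sphere 0 1 := by
  obtain ⟨p, hp, -⟩ := S.exists_pair
  obtain ⟨E, c, r, hE, hc, hr, hS⟩ := S.isRoundSphere
  have hbot : E.direction ≠ ⊥ := by
    intro h
    rw [h, finrank_bot] at hE
    omega
  have hcone : {x | lightVector x ∈ S.cone} = (affineSpan ℝ S.carrier : Set _) :=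
    Set.ext fun x => lightVector_mem_span_image_iff hp
  rw [hcone, hS]
  exact inter_sphere_eq_affineSpan_inter_sphere_zero hc hr zero_le_one hbot
    (hS ▸ S.subset_sphere)

theorem det_frameBasis (S : OrientedSphere q n) (x : S.carrier)
    (b b' : Basis (Fin (q + 1)) ℝ (vectorSpan ℝ S.carrier)) :
    (S.frameBasis x b).det (S.frameBasis x b') = b.det b' := by
  -- `v ↦ det ((1, x), (0, v))` is an alternating form on the direction of `Σ`
  let space : vectorSpan ℝ S.carrier →ₗ[ℝ] S.cone :=
    ((spaceVector n).domRestrict _).codRestrict _ fun v => S.spaceVector_mem v.2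
  let f := ((S.frameBasis x b).det.curryLeft ⟨lightVector x, S.lightVector_mem x.2⟩).compLinearMap
    space
  have hf : ∀ d : Basis (Fin (q + 1)) ℝ (vectorSpan ℝ S.carrier),
      f d = (S.frameBasis x b).det (S.frameBasis x d) := by
    intro d
    simp only [frameBasis, Basis.coe_mk]
    rfl
  rw [← hf b', f.eq_smul_basis_det b, hf b, Basis.det_self, one_smul]

theorem someBasis_orientation (S : OrientedSphere q n) : S.someBasis.orientation = S.orientation :=
  S.orientation.someBasis_orientation _

theorem toPlane_injective :
    Function.Injective (toPlane : OrientedSphere q n → LorentzPlane q n) := by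
  intro S S' h
  have hcarrier : S.carrier = S'.carrier := by
    rw [S.carrier_eq, S'.carrier_eq, show S.cone = S'.cone from congrArg LorentzPlane.carrier h]
  obtain ⟨C, hC, hround, o⟩ := S
  obtain ⟨_, _, _, o'⟩ := S'
  obtain rfl : C = _ := hcarrier
  let S : OrientedSphere q n := ⟨C, hC, hround, o⟩
  let S' : OrientedSphere q n := ⟨C, hC, hround, o'⟩
  injection h with _ horientation
  have hdet : 0 < S.someBasis.det S'.someBasis := by
    rw [← det_frameBasis S S.somePoint]
    exact (Basis.orientation_eq_iff_det_pos _ _).1 horientation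
  have ho : S.someBasis.orientation = S'.someBasis.orientation :=
    (Basis.orientation_eq_iff_det_pos _ _).2 hdet
  obtain rfl : o = o' := S.someBasis_orientation.symm.trans (ho.trans S'.someBasis_orientation)
  rfl

theorem exists_ne_cone_eq (P : LorentzPlane q n) :
    ∃ S S' : OrientedSphere q n, S ≠ S' ∧ S.cone = P.carrier ∧ S'.cone = P.carrier := by
  obtain ⟨w, hw, hneg⟩ := P.exists_timelike
  obtain ⟨x, hx, hx1⟩ := exists_lightVector_mem_norm_lt_one hw hneg
  obtain ⟨c, hc, hcx, horth⟩ := exists_center hx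
  set E := AffineSubspace.mk' c (spacePart P.carrier)
  have hcE : c ∈ E := AffineSubspace.self_mem_mk' _ _
  have hdir : E.direction = spacePart P.carrier := AffineSubspace.direction_mk' _ _
  have hfin : finrank ℝ E.direction = q + 1 := by
    have := finrank_spacePart_add_one hc
    rw [P.finrank_carrier] at this
    rw [hdir]
    omega
  have hr : 0 < 1 - ‖c‖ ^ 2 := by nlinarith [norm_nonneg c]
  set C := (E : Set (EuclideanSpace ℝ (Fin (n + 1)))) ∩ Metric.sphere c (√(1 - ‖c‖ ^ 2)) with hC
  have hsub : C ⊆ Metric.sphere 0 1 := by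
    rw [hC, inter_sphere_eq_inter_sphere_zero hcE (by rwa [hdir]) (Real.sqrt_nonneg _) zero_le_one
      (by rw [Real.sq_sqrt hr.le]; ring)]
    exact Set.inter_subset_right
  let S (o) : OrientedSphere q n := ⟨C, hsub, ⟨E, c, _, hfin, hcE, Real.sqrt_pos.2 hr, rfl⟩, o⟩
  have hcone : ∀ o, (S o).cone = P.carrier := fun o => by
    refine Submodule.eq_of_le_of_finrank_eq (Submodule.span_le.2 ?_)
      ((S o).toPlane.finrank_carrier.trans P.finrank_carrier.symm)
    rintro _ ⟨y, hy, rfl⟩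
    have hyc : y - c ∈ spacePart P.carrier := hdir ▸ AffineSubspace.vsub_mem_direction hy.1 hcE
    rw [← add_sub_cancel c y, lightVector_add]
    exact P.carrier.add_mem hc hyc
  let o : Orientation ℝ (vectorSpan ℝ C) (Fin (q + 1)) :=
    (finBasisOfFinrankEq ℝ _ (by
      rw [hC, vectorSpan_inter_sphere hcE (Real.sqrt_pos.2 hr), hfin])).orientation
  refine ⟨S o, S (-o), fun h => Module.Ray.ne_neg_self o ?_, hcone _, hcone _⟩
  injection h

theorem toPlane_surjective :
    Function.Surjective (toPlane : OrientedSphere q n → LorentzPlane q n) := by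
  intro P
  obtain ⟨S, S', hne, hS, hS'⟩ := exists_ne_cone_eq P
  rcases LorentzPlane.eq_or_eq_of_carrier_eq (toPlane_injective.ne hne) hS hS' with h | h
  exacts [⟨S, h⟩, ⟨S', h⟩]

theorem toPlane_bijective :
    Function.Bijective (toPlane : OrientedSphere q n → LorentzPlane q n) :=
  ⟨toPlane_injective, toPlane_surjective⟩

end OrientedSphere

/-! ### Exterior powers in Plücker coordinates -/

/-- The exterior power `⋀^{q+2} ℝ^{n+2}` in the coordinates with respect to the basis of the
vectors `e_{i₁} ∧ ⋯ ∧ e_{i_{q+2}}`, `i₁ < ⋯ < i_{q+2}`. -/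
def pluckerEquiv (q n : ℕ) : ⋀[ℝ]^(q + 2) (Fin (n + 2) → ℝ) ≃ₗ[ℝ] PluckerSpace q n :=
  (((Pi.basisFun ℝ (Fin (n + 2))).exteriorPower (q + 2)).reindex
    Set.powersetCard.ofFinEmbEquiv.symm).equivFun

/-- The standard basis vectors of `ℝᵐ` with indices `k 0, k 1, …`. -/
def stdFrame {r m : ℕ} (k : Fin r → Fin m) : Fin r → Fin m → ℝ := fun i => Pi.single (k i) 1

section Plucker

variable {q n : ℕ}

theorem pluckerEquiv_ιMulti (x : Fin (q + 2) → Fin (n + 2) → ℝ) :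
    pluckerEquiv q n (exteriorPower.ιMulti ℝ (q + 2) x) = wedge x := by
  ext I
  simp [pluckerEquiv, exteriorPower.basis_repr_apply, wedge]

theorem pluckerEquiv_symm_wedge (x : Fin (q + 2) → Fin (n + 2) → ℝ) :
    (pluckerEquiv q n).symm (wedge x) = exteriorPower.ιMulti ℝ (q + 2) x := by
  rw [← pluckerEquiv_ιMulti, LinearEquiv.symm_apply_apply]

theorem wedge_stdFrame (I : Fin (q + 2) ↪o Fin (n + 2)) :
    (wedge (stdFrame I) : PluckerSpace q n) = Pi.single I 1 := by
  have h : exteriorPower.ιMulti ℝ (q + 2) (stdFrame I) =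
      (Pi.basisFun ℝ (Fin (n + 2))).exteriorPower (q + 2)
        (Set.powersetCard.ofFinEmbEquiv I) := by
    rw [exteriorPower.basis_apply, exteriorPower.ιMulti_family, Equiv.symm_apply_apply]
    congr 1
    ext1 i
    simp [stdFrame]
  rw [← pluckerEquiv_ιMulti, h, pluckerEquiv, Basis.equivFun_apply, Basis.repr_reindex,
    Basis.repr_self]
  ext J
  simp [Finsupp.single_apply, Pi.single_apply, eq_comm]

theorem sum_smul_wedge_stdFrame (p : PluckerSpace q n) :
    ∑ I, p I • wedge (stdFrame I) = p := by
  simp only [wedge_stdFrame]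
  exact pi_eq_sum_univ' p |>.symm

theorem pluckerSpace_linearMap_ext {N : Type*} [AddCommMonoid N] [Module ℝ N]
    {f g : PluckerSpace q n →ₗ[ℝ] N} (h : ∀ x, f (wedge x) = g (wedge x)) : f = g := by
  refine LinearMap.pi_ext' fun I => LinearMap.ext_ring ?_
  rw [LinearMap.comp_apply, LinearMap.comp_apply, LinearMap.single_apply, ← wedge_stdFrame]
  exact h _

theorem wedge_matrix_mul (T : Matrix (Fin (q + 2)) (Fin (q + 2)) ℝ)
    (x : Fin (q + 2) → Fin (n + 2) → ℝ) :
    (wedge (fun i => ∑ j, T i j • x j) : PluckerSpace q n) = T.det • wedge x := by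
  funext I
  rw [Pi.smul_apply, smul_eq_mul, wedge, wedge, ← Matrix.det_mul]
  congr 1
  ext i k
  simp [Matrix.mul_apply]

/-- The Plücker coordinate `p_k` for a sequence `k` of indices that need not be increasing. -/
def coord (k : Fin (q + 2) → Fin (n + 2)) : PluckerSpace q n →ₗ[ℝ] ℝ :=
  exteriorPower.pairingDual ℝ _ _ (exteriorPower.ιMulti ℝ _ fun l => LinearMap.proj (k l)) ∘ₗ
    (pluckerEquiv q n).symm.toLinearMap

theorem coord_wedge (k : Fin (q + 2) → Fin (n + 2)) (x : Fin (q + 2) → Fin (n + 2) → ℝ) :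
    coord k (wedge x) = (Matrix.of fun i l => x i (k l)).det := by
  simp [coord, pluckerEquiv_symm_wedge, exteriorPower.pairingDual_ιMulti_ιMulti]

/-- The endomorphism `⋀^{q+2} A` of `⋀^{q+2} ℝ^{n+2}`; its matrix is the compound matrix of the
minors of `A`. -/
def compound (A : Matrix (Fin (n + 2)) (Fin (n + 2)) ℝ) :
    PluckerSpace q n →ₗ[ℝ] PluckerSpace q n :=
  (pluckerEquiv q n).conj (exteriorPower.map (q + 2) A.mulVecLin)

theorem compound_wedge (A : Matrix (Fin (n + 2)) (Fin (n + 2)) ℝ)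
    (x : Fin (q + 2) → Fin (n + 2) → ℝ) :
    compound A (wedge x) = wedge fun i => A *ᵥ x i := by
  simp only [compound, LinearEquiv.conj_apply_apply, pluckerEquiv_symm_wedge,
    exteriorPower.map_apply_ιMulti, pluckerEquiv_ιMulti]
  rfl

theorem compound_one : (compound 1 : PluckerSpace q n →ₗ[ℝ] _) = LinearMap.id := by
  rw [compound, Matrix.mulVecLin_one, exteriorPower.map_id, LinearEquiv.conj_id]

theorem compound_mul (A B : Matrix (Fin (n + 2)) (Fin (n + 2)) ℝ) :
    (compound (A * B) : PluckerSpace q n →ₗ[ℝ] _) = compound A ∘ₗ compound B := by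
  rw [compound, Matrix.mulVecLin_mul, exteriorPower.map_comp, LinearEquiv.conj_comp]
  rfl

theorem compound_apply (A : Matrix (Fin (n + 2)) (Fin (n + 2)) ℝ) (p : PluckerSpace q n)
    (J : Fin (q + 2) ↪o Fin (n + 2)) :
    compound A p J = ∑ I : Fin (q + 2) ↪o Fin (n + 2), p I * (A.submatrix J I).det := by
  have hminor : ∀ I : Fin (q + 2) ↪o Fin (n + 2),
      (wedge fun i => A *ᵥ stdFrame I i : PluckerSpace q n) J = (A.submatrix J I).det := by
    intro I
    rw [← Matrix.det_transpose, wedge]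
    congr 1
    ext i k
    simp [stdFrame]
  conv_lhs => rw [← sum_smul_wedge_stdFrame p]
  simp only [map_sum, map_smul, compound_wedge, Finset.sum_apply, Pi.smul_apply, smul_eq_mul,
    hminor]

/-- The form `⟨ξ, η⟩` on the exterior power, computed with Mathlib's pairing of `⋀V*` and `⋀V`. -/
theorem pluckerForm_eq_neg_pairingDual :
    pluckerForm q n = -((exteriorPower.pairingDual ℝ (Fin (n + 2) → ℝ) (q + 2) ∘ₗ
      exteriorPower.map (q + 2) (minkowskiForm (n + 2))).compl₁₂
        (pluckerEquiv q n).symm.toLinearMap (pluckerEquiv q n).symm.toLinearMap) := by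
  refine LinearMap.BilinForm.ext_basis (Pi.basisFun ℝ _) fun I J => ?_
  rw [Pi.basisFun_apply, Pi.basisFun_apply]
  conv_rhs => rw [← wedge_stdFrame, ← wedge_stdFrame]
  simp only [LinearMap.neg_apply, LinearMap.compl₁₂_apply, LinearEquiv.coe_coe,
    pluckerEquiv_symm_wedge, LinearMap.comp_apply, exteriorPower.map_apply_ιMulti,
    exteriorPower.pairingDual_ιMulti_ιMulti]
  rw [pluckerForm, Matrix.toBilin'_single, Matrix.of_apply, ← Matrix.det_transpose]
  congr 2
  ext i j
  simp [stdFrame, minkowskiForm, Matrix.toBilin'_single]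

theorem pluckerForm_wedge (x y : Fin (q + 2) → Fin (n + 2) → ℝ) :
    pluckerForm q n (wedge x) (wedge y) =
      -(Matrix.of fun i j => minkowskiForm (n + 2) (x i) (y j)).det := by
  simp only [pluckerForm_eq_neg_pairingDual, LinearMap.neg_apply, LinearMap.compl₁₂_apply,
    LinearEquiv.coe_coe, pluckerEquiv_symm_wedge, LinearMap.comp_apply,
    exteriorPower.map_apply_ιMulti, exteriorPower.pairingDual_ιMulti_ιMulti]
  rw [← Matrix.det_transpose]
  rfl

theorem pluckerForm_comm (p p' : PluckerSpace q n) :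
    pluckerForm q n p p' = pluckerForm q n p' p := by
  suffices (pluckerForm q n).flip = pluckerForm q n from LinearMap.congr_fun₂ this p' p
  refine pluckerSpace_linearMap_ext fun x => pluckerSpace_linearMap_ext fun y => ?_
  change pluckerForm q n (wedge y) (wedge x) = _
  rw [pluckerForm_wedge, pluckerForm_wedge, ← Matrix.det_transpose]
  congr 2
  ext i j
  exact minkowskiForm_comm _ _

theorem pluckerForm_compound (A : SOLorentz (n + 2)) (p p' : PluckerSpace q n) :
    pluckerForm q n (compound (A : GL (Fin (n + 2)) ℝ) p)
      (compound (A : GL (Fin (n + 2)) ℝ) p') = pluckerForm q n p p' := by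
  suffices (pluckerForm q n).compl₁₂ (compound (A : GL (Fin (n + 2)) ℝ))
      (compound (A : GL (Fin (n + 2)) ℝ)) = pluckerForm q n from
    LinearMap.congr_fun₂ this p p'
  refine pluckerSpace_linearMap_ext fun x => pluckerSpace_linearMap_ext fun y => ?_
  rw [LinearMap.compl₁₂_apply, compound_wedge, compound_wedge, pluckerForm_wedge,
    pluckerForm_wedge]
  simp only [← glEquiv_apply, minkowskiForm_glEquiv]

end Plucker

/-! ### Frames of oriented planes -/

/-- The vectors `x` form a basis of the plane `P` that gives its orientation. -/
def IsFrame {q n : ℕ} (P : LorentzPlane q n) (x : Fin (q + 2) → Fin (n + 2) → ℝ) : Prop :=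
  ∃ b : Basis (Fin (q + 2)) ℝ P.carrier, (∀ i, (b i : Fin (n + 2) → ℝ) = x i) ∧
    b.orientation = P.orientation

namespace IsFrame

variable {q n : ℕ} {P P' : LorentzPlane q n} {x y : Fin (q + 2) → Fin (n + 2) → ℝ}

theorem carrier_eq (h : IsFrame P x) : P.carrier = Submodule.span ℝ (Set.range x) := by
  obtain ⟨b, hb, -⟩ := h
  have hx : x = P.carrier.subtype ∘ b := funext fun i => (hb i).symm
  rw [hx, Set.range_comp, Submodule.span_image, b.span_eq, Submodule.map_top,
    Submodule.range_subtype]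

theorem eq_of_map (A : SOLorentz (n + 2)) (h : IsFrame P x)
    (h' : IsFrame P' fun i => glEquiv (A : GL (Fin (n + 2)) ℝ) (x i)) : A • P = P' := by
  obtain ⟨b, hb, ho⟩ := h
  obtain ⟨b', hb', ho'⟩ := h'
  refine LorentzPlane.map_eq_of_equiv A (b.equiv b' (Equiv.refl _)) (fun w => ?_) ?_
  · have : P'.carrier.subtype ∘ₗ (b.equiv b' (Equiv.refl _) : P.carrier →ₗ[ℝ] P'.carrier) =
        (glEquiv (A : GL (Fin (n + 2)) ℝ) : (Fin (n + 2) → ℝ) →ₗ[ℝ] _) ∘ₗ P.carrier.subtype :=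
      b.ext fun i => by simp [hb, hb']
    exact LinearMap.congr_fun this w
  · rw [← ho, ← ho', ← Basis.orientation_map]
    congr 1
    ext i : 1
    simp

theorem unique (h : IsFrame P x) (h' : IsFrame P' x) : P = P' := by
  rw [← eq_of_map (1 : SOLorentz (n + 2)) h (P' := P') (by simpa [glEquiv_one] using h'), one_smul]

theorem map (A : SOLorentz (n + 2)) (h : IsFrame P x) :
    IsFrame (A • P) fun i => glEquiv (A : GL (Fin (n + 2)) ℝ) (x i) := by
  obtain ⟨b, hb, ho⟩ := h
  refine ⟨b.map ((glEquiv (A : GL (Fin (n + 2)) ℝ)).submoduleMap P.carrier), fun i => ?_, ?_⟩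
  · exact congrArg (glEquiv (A : GL (Fin (n + 2)) ℝ)) (hb i)
  · exact (Basis.orientation_map b _).trans (by rw [ho]; rfl)

theorem exists_matrix (h : IsFrame P x) (h' : IsFrame P y) :
    ∃ T : Matrix (Fin (q + 2)) (Fin (q + 2)) ℝ, 0 < T.det ∧ y = fun i => ∑ j, T i j • x j := by
  obtain ⟨b, hb, ho⟩ := h
  obtain ⟨b', hb', ho'⟩ := h'
  refine ⟨(b.toMatrix b')ᵀ, ?_, funext fun i => ?_⟩
  · rw [Matrix.det_transpose, ← Basis.det_apply, ← Basis.orientation_eq_iff_det_pos, ho, ho']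
  · have := congrArg P.carrier.subtype (b.sum_toMatrix_smul_self b' i)
    simpa only [map_sum, map_smul, Submodule.subtype_apply, hb, hb', Matrix.transpose_apply]
      using this.symm

theorem matrix_mul (h : IsFrame P x) {T : Matrix (Fin (q + 2)) (Fin (q + 2)) ℝ} (hT : 0 < T.det) :
    IsFrame P fun i => ∑ j, T i j • x j := by
  obtain ⟨b, hb, ho⟩ := h
  let v : Fin (q + 2) → P.carrier := fun i => ∑ j, T i j • b j
  have hmatrix : b.toMatrix v = Tᵀ := by
    ext i j
    simp [v, Basis.toMatrix_apply, Finsupp.single_apply]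
  have hdet : b.det v = T.det := by rw [Basis.det_apply, hmatrix, Matrix.det_transpose]
  obtain ⟨hindep, hspan⟩ := (Basis.is_basis_iff_det b (v := v)).2 (hdet ▸ hT.ne'.isUnit)
  refine ⟨Basis.mk hindep hspan.ge, fun i => ?_, ?_⟩
  · simp [v, hb]
  · rwa [← ho, eq_comm, Basis.orientation_eq_iff_det_pos, Basis.coe_mk, hdet]

end IsFrame

theorem LorentzPlane.isFrame_someBasis {q n : ℕ} (P : LorentzPlane q n) :
    IsFrame P fun i =>
      P.orientation.someBasis (by rw [P.finrank_carrier, Fintype.card_fin]) i :=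
  ⟨_, fun _ => rfl, P.orientation.someBasis_orientation _⟩

theorem exists_isFrame {q n : ℕ} {x : Fin (q + 2) → Fin (n + 2) → ℝ} (hx : LinearIndependent ℝ x)
    (ht : ∃ v ∈ Submodule.span ℝ (Set.range x), minkowskiForm (n + 2) v v < 0) :
    ∃ P : LorentzPlane q n, IsFrame P x := by
  obtain ⟨v, hv, hneg⟩ := ht
  exact ⟨{  carrier := Submodule.span ℝ (Set.range x)
            finrank_carrier := by rw [finrank_span_eq_card hx, Fintype.card_fin]
            nondegenerate := nondegenerate_of_timelike hv hneg
            index_eq_one := sigNeg_of_timelike hv hneg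
            orientation := (Basis.span hx).orientation },
    Basis.span hx, fun i => congrArg Subtype.val (Basis.span_apply hx i), rfl⟩

/-! ### Pseudo-orthonormal frames -/

theorem exists_orthonormal_basis {V : Type*} [AddCommGroup V] [Module ℝ V] [FiniteDimensional ℝ V]
    {B : LinearMap.BilinForm ℝ V} (hs : B.IsSymm) (hp : ∀ v, v ≠ 0 → 0 < B v v) {k : ℕ}
    (hk : finrank ℝ V = k) :
    ∃ b : Basis (Fin k) ℝ V, ∀ i j, B (b i) (b j) = if i = j then 1 else 0 := by
  subst hk
  obtain ⟨v, hv⟩ :=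
    LinearMap.BilinForm.exists_orthogonal_basis (LinearMap.BilinForm.isSymm_iff.1 hs)
  have hpos : ∀ i, 0 < B (v i) (v i) := fun i => hp _ (v.ne_zero i)
  refine ⟨v.isUnitSMul (w := fun i => (√(B (v i) (v i)))⁻¹)
    fun i => (inv_ne_zero (Real.sqrt_pos.2 (hpos i)).ne').isUnit, fun i j => ?_⟩
  simp only [Basis.isUnitSMul_apply, map_smul, LinearMap.smul_apply, smul_eq_mul]
  split_ifs with hij
  · subst hij
    rw [← mul_assoc, ← mul_inv, Real.mul_self_sqrt (hpos i).le, inv_mul_cancel₀ (hpos i).ne']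
  · rw [show B (v i) (v j) = 0 from hv hij, mul_zero, mul_zero]

/-- The square of the `i`-th vector of a pseudo-orthonormal frame: `-1` for `i = 0`, otherwise
`1`. -/
def eps {m : ℕ} (i : Fin m) : ℝ := if i.val = 0 then -1 else 1

theorem eps_zero {m : ℕ} : eps (0 : Fin (m + 1)) = -1 := if_pos rfl

theorem eps_of_ne_zero {m : ℕ} {i : Fin (m + 1)} (hi : i ≠ 0) : eps i = 1 :=
  if_neg fun h => hi (Fin.ext h)

theorem eps_mul_self {m : ℕ} (i : Fin m) : eps i * eps i = 1 := by
  unfold eps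
  split_ifs <;> norm_num

theorem eps_ne_zero {m : ℕ} (i : Fin m) : eps i ≠ 0 :=
  left_ne_zero_of_mul_eq_one (eps_mul_self i)

theorem prod_eps (m : ℕ) : ∏ i : Fin (m + 1), eps i = -1 := by
  simp [Fin.prod_univ_succ, eps_zero, eps_of_ne_zero (Fin.succ_ne_zero _)]

/-- A family of vectors whose Gram matrix is `diag(-1, 1, …, 1)`. -/
def IsPseudoOrthonormal {V : Type*} [AddCommGroup V] [Module ℝ V] (B : LinearMap.BilinForm ℝ V)
    {m : ℕ} (x : Fin m → V) : Prop :=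
  ∀ i j, B (x i) (x j) = if i = j then eps i else 0

namespace IsPseudoOrthonormal

variable {V : Type*} [AddCommGroup V] [Module ℝ V] {B : LinearMap.BilinForm ℝ V}

theorem gram_eq {m : ℕ} {x : Fin m → V} (h : IsPseudoOrthonormal B x) :
    (Matrix.of fun i j => B (x i) (x j)) = Matrix.diagonal eps := by
  ext i j
  rw [Matrix.of_apply, h, Matrix.diagonal_apply]

theorem linearIndependent {m : ℕ} {x : Fin m → V} (h : IsPseudoOrthonormal B x) :
    LinearIndependent ℝ x := by
  refine LinearMap.BilinForm.linearIndependent_of_iIsOrtho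
    (LinearMap.BilinForm.iIsOrtho_def.2 fun i j hij => (h i j).trans (if_neg hij)) fun i hi => ?_
  exact eps_ne_zero i (((h i i).trans (if_pos rfl)).symm.trans hi)

theorem smul {m : ℕ} {x : Fin m → V} (h : IsPseudoOrthonormal B x) {s : Fin m → ℝ}
    (hs : ∀ i, s i * s i = 1) : IsPseudoOrthonormal B fun i => s i • x i := by
  intro i j
  simp only [map_smul, LinearMap.smul_apply, smul_eq_mul, h i j]
  split_ifs with hij
  · rw [← hij, ← mul_assoc, hs, one_mul]
  · rw [mul_zero, mul_zero]

theorem adjustToOrientation {m : ℕ} {b : Basis (Fin (m + 1)) ℝ V} (h : IsPseudoOrthonormal B b)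
    (o : Orientation ℝ V (Fin (m + 1))) : IsPseudoOrthonormal B (b.adjustToOrientation o) := by
  have hsign : ∀ i, ∃ s : ℝ, s * s = 1 ∧ b.adjustToOrientation o i = s • b i := fun i => by
    rcases b.adjustToOrientation_apply_eq_or_eq_neg o i with hi | hi
    · exact ⟨1, by norm_num, by rw [hi, one_smul]⟩
    · exact ⟨-1, by norm_num, by rw [hi, neg_one_smul]⟩
  choose s hs hb using hsign
  rw [show ⇑(b.adjustToOrientation o) = fun i => s i • b i from funext hb]
  exact h.smul hs

theorem cons (hB : B.IsSymm) {v : V} (hv : B v v = -1) {k : ℕ} {w : Fin k → V}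
    (hw : ∀ i j, B (w i) (w j) = if i = j then 1 else 0) (hvw : ∀ i, B v (w i) = 0) :
    IsPseudoOrthonormal B (Fin.cons v w : Fin (k + 1) → V) := by
  intro i j
  induction i using Fin.cases with
  | zero =>
    induction j using Fin.cases with
    | zero => simp [hv, eps_zero]
    | succ j => simp [hvw, (Fin.succ_ne_zero j).symm]
  | succ i =>
    induction j using Fin.cases with
    | zero => simp [hB.eq v (w i) ▸ hvw i]
    | succ j => simp [hw, eps_of_ne_zero (Fin.succ_ne_zero i)]

end IsPseudoOrthonormal

theorem exists_pseudoOrthonormal_basis {V : Type*} [AddCommGroup V] [Module ℝ V]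
    [FiniteDimensional ℝ V] {B : LinearMap.BilinForm ℝ V} (hB : B.IsSymm) {v : V} (hv : B v v < 0)
    (hpos : ∀ w, w ≠ 0 → B v w = 0 → 0 < B w w) {k : ℕ} (hk : finrank ℝ V = k + 1) :
    ∃ b : Basis (Fin (k + 1)) ℝ V, IsPseudoOrthonormal B b := by
  have hBv : B v ≠ 0 := fun h => hv.ne (LinearMap.congr_fun h v)
  have hker : finrank ℝ (LinearMap.ker (B v)) = k := by
    have := Module.Dual.finrank_ker_add_one_of_ne_zero hBv
    omega
  obtain ⟨w, hw⟩ := exists_orthonormal_basis (hB.restrict (LinearMap.ker (B v)))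
    (fun w hw => hpos w (fun h => hw (Subtype.ext h)) w.2) hker
  have hunit : B ((√(-B v v))⁻¹ • v) ((√(-B v v))⁻¹ • v) = -1 := by
    simp only [map_smul, LinearMap.smul_apply, smul_eq_mul]
    rw [← mul_assoc, ← mul_inv, Real.mul_self_sqrt (neg_pos.2 hv).le, inv_neg, neg_mul,
      inv_mul_cancel₀ hv.ne]
  have hcons := IsPseudoOrthonormal.cons (w := fun i => (w i : V)) hB hunit hw fun i => by
    rw [map_smul, LinearMap.smul_apply, show B v (w i) = 0 from (w i).2, smul_zero]
  refine ⟨basisOfLinearIndependentOfCardEqFinrank hcons.linearIndependent (by simp [hk]), ?_⟩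
  rwa [coe_basisOfLinearIndependentOfCardEqFinrank]

theorem minkowskiMatrix_eq (m : ℕ) : minkowskiMatrix m = Matrix.diagonal eps := rfl

theorem minkowskiForm_isSymm (m : ℕ) : (minkowskiForm (m + 1)).IsSymm :=
  ⟨minkowskiForm_comm⟩

theorem det_minkowskiMatrix_ne_zero (m : ℕ) : (minkowskiMatrix m).det ≠ 0 := by
  rw [minkowskiMatrix_eq, Matrix.det_diagonal]
  exact Finset.prod_ne_zero_iff.2 fun i _ => eps_ne_zero i

theorem minkowskiForm_nondegenerate (m : ℕ) : (minkowskiForm m).Nondegenerate :=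
  LinearMap.BilinForm.nondegenerate_toBilin'_of_det_ne_zero' _ (det_minkowskiMatrix_ne_zero m)

theorem pos_of_orthogonal_timelike {m : ℕ} {v w : Fin (m + 1) → ℝ}
    (hv : minkowskiForm (m + 1) v v < 0) (hw : w ≠ 0) (hvw : minkowskiForm (m + 1) v w = 0) :
    0 < minkowskiForm (m + 1) w w := by
  by_contra h
  exact hw (eq_zero_of_orthogonal_timelike hv (not_lt.1 h) hvw)

theorem minkowskiForm_single_single {m : ℕ} (i j : Fin m) :
    minkowskiForm m (Pi.single i 1) (Pi.single j 1) = if i = j then eps i else 0 := by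
  rw [minkowskiForm, Matrix.toBilin'_single, minkowskiMatrix_eq, Matrix.diagonal_apply]

theorem LorentzPlane.exists_pseudoOrthonormal_frame {q n : ℕ} (P : LorentzPlane q n) :
    ∃ x, IsFrame P x ∧ IsPseudoOrthonormal (minkowskiForm (n + 2)) x := by
  obtain ⟨v, hvP, hv⟩ := P.exists_timelike
  obtain ⟨b, hb⟩ := exists_pseudoOrthonormal_basis (v := (⟨v, hvP⟩ : P.carrier))
    ((minkowskiForm_isSymm (n + 1)).restrict P.carrier) hv
    (fun w hw hvw => pos_of_orthogonal_timelike hv (fun h => hw (Subtype.ext h)) hvw)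
    P.finrank_carrier
  exact ⟨fun i => b.adjustToOrientation P.orientation i,
    ⟨_, fun _ => rfl, b.orientation_adjustToOrientation _⟩, hb.adjustToOrientation P.orientation⟩

/-! ### Transitivity -/

theorem transpose_mul_minkowskiMatrix_mul {m : ℕ} (M : Matrix (Fin m) (Fin m) ℝ) (k l : Fin m) :
    (Mᵀ * minkowskiMatrix m * M) k l = minkowskiForm m (M.col k) (M.col l) := by
  rw [minkowskiForm, Matrix.toBilin'_apply', Matrix.mul_assoc, Matrix.mul_apply']
  rfl

theorem IsPseudoOrthonormal.transpose_mul_minkowskiMatrix_mul {m : ℕ} {M : Matrix (Fin m) (Fin m) ℝ}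
    (hM : IsPseudoOrthonormal (minkowskiForm m) M.col) :
    Mᵀ * minkowskiMatrix m * M = minkowskiMatrix m := by
  ext k l
  rw [SphereSpace.transpose_mul_minkowskiMatrix_mul, hM, minkowskiMatrix_eq, Matrix.diagonal_apply]

theorem det_mul_det_eq_one {m : ℕ} {M : Matrix (Fin m) (Fin m) ℝ}
    (hM : Mᵀ * minkowskiMatrix m * M = minkowskiMatrix m) : M.det * M.det = 1 := by
  have h := congrArg Matrix.det hM
  rw [Matrix.det_mul, Matrix.det_mul, Matrix.det_transpose] at h
  refine mul_right_cancel₀ (det_minkowskiMatrix_ne_zero m) ?_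
  linarith

/-- The exceptional index leaves room to correct the sign of the determinant. -/
theorem IsPseudoOrthonormal.exists_specialLorentz {m : ℕ} {f : Fin m → Fin m → ℝ}
    (hf : IsPseudoOrthonormal (minkowskiForm m) f) (k₀ : Fin m) :
    ∃ A : SOLorentz m, ∀ k, k ≠ k₀ → glEquiv (A : GL (Fin m) ℝ) (Pi.single k 1) = f k := by
  let M : Matrix (Fin m) (Fin m) ℝ := (Matrix.of f)ᵀ
  have hdet : M.det * M.det = 1 :=
    det_mul_det_eq_one (IsPseudoOrthonormal.transpose_mul_minkowskiMatrix_mul (M := M) hf)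
  let s : Fin m → ℝ := Function.update 1 k₀ M.det
  have hs : ∀ k, s k * s k = 1 := fun k => by
    rcases eq_or_ne k k₀ with rfl | hk
    · simp [s, hdet]
    · simp [s, hk]
  let N : Matrix (Fin m) (Fin m) ℝ := (Matrix.of fun k => s k • f k)ᵀ
  have hN : N.det = 1 := by
    have : N = M * Matrix.diagonal s := by
      ext i k
      simp [N, M, mul_comm]
    rw [this, Matrix.det_mul, Matrix.det_diagonal,
      Finset.prod_update_of_mem (Finset.mem_univ _)]
    simp [hdet]
  refine ⟨⟨Matrix.GeneralLinearGroup.mkOfDetNeZero N (hN ▸ one_ne_zero),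
    IsPseudoOrthonormal.transpose_mul_minkowskiMatrix_mul (M := N) (hf.smul hs), hN⟩,
    fun k hk => ?_⟩
  rw [glEquiv_apply, Matrix.mulVec_single_one]
  change s k • f k = f k
  simp [s, hk]

/-- The splitting of the coordinates into the first `q + 2` and the last `n - q`. -/
def blockIndex {q n : ℕ} (h : q ≤ n) : Fin (q + 2) ⊕ Fin (n - q) ≃ Fin (n + 2) :=
  finSumFinEquiv.trans (finCongr (show q + 2 + (n - q) = n + 2 by omega))

/-- The indices of the first `q + 2` coordinates, as an increasing sequence. -/
def baseEmb {q n : ℕ} (h : q ≤ n) : Fin (q + 2) ↪o Fin (n + 2) :=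
  Fin.castLEOrderEmb (by omega)

section BlockIndex

variable {q n : ℕ} (h : q ≤ n)

theorem blockIndex_inl (i : Fin (q + 2)) : blockIndex h (Sum.inl i) = baseEmb h i := rfl

theorem blockIndex_inr_ne_baseEmb (i : Fin (q + 2)) (j : Fin (n - q)) :
    blockIndex h (Sum.inr j) ≠ baseEmb h i := by
  simp [← blockIndex_inl]

theorem eps_baseEmb (i : Fin (q + 2)) : eps (baseEmb h i) = eps i := rfl

theorem eps_inr (j : Fin (n - q)) : eps (blockIndex h (Sum.inr j)) = 1 := by
  simp [eps, blockIndex]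

end BlockIndex

theorem isPseudoOrthonormal_stdFrame {q n : ℕ} (h : q ≤ n) :
    IsPseudoOrthonormal (minkowskiForm (n + 2)) (stdFrame (baseEmb h)) := by
  intro i j
  rw [stdFrame, stdFrame, minkowskiForm_single_single, eps_baseEmb]
  simp only [EmbeddingLike.apply_eq_iff_eq]

theorem IsPseudoOrthonormal.sumElim {q n : ℕ} (h : q ≤ n) {x : Fin (q + 2) → Fin (n + 2) → ℝ}
    (hx : IsPseudoOrthonormal (minkowskiForm (n + 2)) x) {c : Fin (n - q) → Fin (n + 2) → ℝ}
    (hc : ∀ i j, minkowskiForm (n + 2) (c i) (c j) = if i = j then 1 else 0)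
    (hxc : ∀ i j, minkowskiForm (n + 2) (x i) (c j) = 0) :
    IsPseudoOrthonormal (minkowskiForm (n + 2)) (Sum.elim x c ∘ (blockIndex h).symm) := by
  intro k l
  obtain ⟨k, rfl⟩ := (blockIndex h).surjective k
  obtain ⟨l, rfl⟩ := (blockIndex h).surjective l
  simp only [Function.comp_apply, Equiv.symm_apply_apply, EmbeddingLike.apply_eq_iff_eq]
  rcases k with k | k <;> rcases l with l | l
  · simp [hx k l, blockIndex_inl, eps_baseEmb]
  · simp [hxc k l]
  · simp [(minkowskiForm_comm _ _).trans (hxc l k)]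
  · simp [hc k l, eps_inr]

theorem LorentzPlane.exists_isFrame_glEquiv_stdFrame {q n : ℕ} (h : q < n) (P : LorentzPlane q n) :
    ∃ A : SOLorentz (n + 2),
      IsFrame P fun i => glEquiv (A : GL (Fin (n + 2)) ℝ) (stdFrame (baseEmb h.le) i) := by
  obtain ⟨x, hx, hxx⟩ := P.exists_pseudoOrthonormal_frame
  obtain ⟨v, hvP, hv⟩ := P.exists_timelike
  set W := (minkowskiForm (n + 2)).orthogonal P.carrier with hW
  have horth : ∀ p ∈ P.carrier, ∀ w ∈ W, minkowskiForm (n + 2) p w = 0 := fun p hp w hw => hw p hp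
  have hfin : finrank ℝ W = n - q := by
    rw [hW, LinearMap.BilinForm.finrank_orthogonal (minkowskiForm_nondegenerate _),
      P.finrank_carrier, finrank_fin_fun]
    omega
  obtain ⟨c, hc⟩ := exists_orthonormal_basis ((minkowskiForm_isSymm (n + 1)).restrict W)
    (fun w hw => pos_of_orthogonal_timelike hv (fun h => hw (Subtype.ext h)) (horth _ hvP _ w.2))
    hfin
  have hxP : ∀ i, x i ∈ P.carrier := fun i => by
    rw [hx.carrier_eq]
    exact Submodule.subset_span ⟨i, rfl⟩
  obtain ⟨A, hA⟩ := (hxx.sumElim h.le (c := fun j => c j) hc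
    fun i j => horth _ (hxP i) _ (c j).2).exists_specialLorentz
      (blockIndex h.le (Sum.inr ⟨0, by omega⟩))
  refine ⟨A, ?_⟩
  convert hx using 1
  funext i
  rw [stdFrame, hA _ (blockIndex_inr_ne_baseEmb h.le i _).symm, ← blockIndex_inl,
    Function.comp_apply, Equiv.symm_apply_apply, Sum.elim_inl]

theorem exists_isFrame_stdFrame {q n : ℕ} (h : q ≤ n) :
    ∃ P : LorentzPlane q n, IsFrame P (stdFrame (baseEmb h)) :=
  exists_isFrame (isPseudoOrthonormal_stdFrame h).linearIndependent
    ⟨stdFrame (baseEmb h) 0, Submodule.subset_span ⟨0, rfl⟩, by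
      rw [isPseudoOrthonormal_stdFrame h, if_pos rfl, eps_zero]
      norm_num⟩

/-- The plane spanned by the first `q + 2` basis vectors, oriented by them. -/
def basePlane {q n : ℕ} (h : q ≤ n) : LorentzPlane q n := (exists_isFrame_stdFrame h).choose

theorem isFrame_basePlane {q n : ℕ} (h : q ≤ n) :
    IsFrame (basePlane h) (stdFrame (baseEmb h)) := (exists_isFrame_stdFrame h).choose_spec

theorem LorentzPlane.exists_smul_basePlane {q n : ℕ} (h : q < n) (P : LorentzPlane q n) :
    ∃ A : SOLorentz (n + 2), A • basePlane h.le = P := by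
  obtain ⟨A, hA⟩ := P.exists_isFrame_glEquiv_stdFrame h
  exact ⟨A, (isFrame_basePlane h.le).eq_of_map A hA⟩

/-! ### Normalized Plücker vectors -/

/-- The unit multiple of a vector `p` with `⟨p, p⟩ > 0`. It is `0` if `⟨p, p⟩ ≤ 0`. -/
def normalize {q n : ℕ} (p : PluckerSpace q n) : PluckerSpace q n :=
  (√(pluckerForm q n p p))⁻¹ • p

theorem normalize_smul {q n : ℕ} {t : ℝ} (ht : 0 < t) (p : PluckerSpace q n) :
    normalize (t • p) = normalize p := by
  simp only [normalize, map_smul, LinearMap.smul_apply, smul_eq_mul]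
  rw [← mul_assoc, Real.sqrt_mul (mul_self_nonneg t), Real.sqrt_mul_self ht.le, smul_smul,
    mul_inv, mul_comm t⁻¹, mul_assoc, inv_mul_cancel₀ ht.ne', mul_one]

theorem compound_normalize {q n : ℕ} (A : SOLorentz (n + 2)) (p : PluckerSpace q n) :
    compound (A : GL (Fin (n + 2)) ℝ) (normalize p) =
      normalize (compound (A : GL (Fin (n + 2)) ℝ) p) := by
  rw [normalize, normalize, pluckerForm_compound, map_smul]

theorem IsPseudoOrthonormal.pluckerForm_wedge {q n : ℕ} {x : Fin (q + 2) → Fin (n + 2) → ℝ}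
    (hx : IsPseudoOrthonormal (minkowskiForm (n + 2)) x) :
    pluckerForm q n (wedge x) (wedge x) = 1 := by
  rw [SphereSpace.pluckerForm_wedge, hx.gram_eq, Matrix.det_diagonal, prod_eps, neg_neg]

namespace IsFrame

variable {q n : ℕ} {P : LorentzPlane q n} {x y : Fin (q + 2) → Fin (n + 2) → ℝ}

theorem normalize_wedge_eq (hx : IsFrame P x) (hy : IsFrame P y) :
    normalize (wedge x : PluckerSpace q n) = normalize (wedge y) := by
  obtain ⟨T, hT, rfl⟩ := hx.exists_matrix hy
  rw [wedge_matrix_mul, normalize_smul hT]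

theorem plucker_eq (hx : IsFrame P x) : P.plucker = normalize (wedge x) :=
  P.isFrame_someBasis.normalize_wedge_eq hx

theorem pluckerForm_pos (hx : IsFrame P x) : 0 < pluckerForm q n (wedge x) (wedge x) := by
  obtain ⟨y, hy, horth⟩ := P.exists_pseudoOrthonormal_frame
  obtain ⟨T, hT, rfl⟩ := hy.exists_matrix hx
  rw [wedge_matrix_mul]
  simp only [map_smul, LinearMap.smul_apply, smul_eq_mul, horth.pluckerForm_wedge]
  positivity

end IsFrame

theorem LorentzPlane.plucker_smul {q n : ℕ} (A : SOLorentz (n + 2)) (P : LorentzPlane q n) :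
    (A • P).plucker = compound (A : GL (Fin (n + 2)) ℝ) P.plucker := by
  have h := P.isFrame_someBasis
  rw [(h.map A).plucker_eq, h.plucker_eq, compound_normalize, compound_wedge]
  rfl

/-! ### Graph coordinates -/

/-- The space of `(q + 2) × (n - q)` matrices, on which the space of spheres is modelled. The entry
`(i, j)` is the coordinate with index `finProdFinEquiv (i, j)`. -/
abbrev Model (q n : ℕ) : Type := EuclideanSpace ℝ (Fin ((q + 2) * (n - q)))

/-- The rows of the matrix `(1 | X)`: a basis of the graph of the linear map with matrix `X` from
the first `q + 2` to the last `n - q` coordinates. -/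
def graphFrame {q n : ℕ} (h : q ≤ n) (X : Model q n) : Fin (q + 2) → Fin (n + 2) → ℝ :=
  fun i k => Sum.elim (fun l => if i = l then 1 else 0) (fun j => X (finProdFinEquiv (i, j)))
    ((blockIndex h).symm k)

section Graph

variable {q n : ℕ} (h : q ≤ n)

theorem graphFrame_baseEmb (X : Model q n) (i l : Fin (q + 2)) :
    graphFrame h X i (baseEmb h l) = if i = l then 1 else 0 := by
  rw [← blockIndex_inl, graphFrame, Equiv.symm_apply_apply, Sum.elim_inl]

theorem graphFrame_inr (X : Model q n) (i : Fin (q + 2)) (j : Fin (n - q)) :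
    graphFrame h X i (blockIndex h (Sum.inr j)) = X (finProdFinEquiv (i, j)) := by
  rw [graphFrame, Equiv.symm_apply_apply, Sum.elim_inr]

theorem graphFrame_zero : graphFrame h (0 : Model q n) = stdFrame (baseEmb h) := by
  funext i k
  obtain ⟨k | k, rfl⟩ := (blockIndex h).surjective k
  · simp [blockIndex_inl, graphFrame_baseEmb, stdFrame, Pi.single_apply, eq_comm]
  · rw [graphFrame_inr, stdFrame, Pi.single_eq_of_ne (blockIndex_inr_ne_baseEmb h i k)]
    rfl

theorem exists_eq_graphFrame {y : Fin (q + 2) → Fin (n + 2) → ℝ}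
    (hy : ∀ i l, y i (baseEmb h l) = if i = l then 1 else 0) :
    ∃ X : Model q n, y = graphFrame h X := by
  refine ⟨WithLp.toLp 2 fun m =>
    y (finProdFinEquiv.symm m).1 (blockIndex h (Sum.inr (finProdFinEquiv.symm m).2)), ?_⟩
  funext i k
  obtain ⟨k | k, rfl⟩ := (blockIndex h).surjective k
  · rw [blockIndex_inl, graphFrame_baseEmb, hy]
  · simp only [graphFrame_inr, Equiv.symm_apply_apply]

theorem linearIndependent_graphFrame (X : Model q n) : LinearIndependent ℝ (graphFrame h X) := by
  rw [Fintype.linearIndependent_iff]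
  intro a ha l
  simpa [graphFrame_baseEmb] using congrFun ha (baseEmb h l)

theorem wedge_graphFrame_baseEmb (X : Model q n) :
    (wedge (graphFrame h X) : PluckerSpace q n) (baseEmb h) = 1 := by
  have : (Matrix.of fun i k => graphFrame h X i (baseEmb h k)) = 1 := by
    ext i k
    rw [Matrix.of_apply, graphFrame_baseEmb, Matrix.one_apply]
  rw [wedge, this, Matrix.det_one]

/-- The first `q + 2` indices, where the `i`-th one is replaced by the `j`-th of the last ones. -/
def exchange (i : Fin (q + 2)) (j : Fin (n - q)) : Fin (q + 2) → Fin (n + 2) :=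
  Function.update (baseEmb h) i (blockIndex h (Sum.inr j))

/-- The Plücker coordinates at the exchanged index sequences. They recover the matrix `X` from
the minors of `(1 | X)`. -/
def slope : PluckerSpace q n →ₗ[ℝ] Model q n :=
  (WithLp.linearEquiv 2 ℝ (Fin ((q + 2) * (n - q)) → ℝ)).symm.toLinearMap ∘ₗ
    LinearMap.pi fun m => coord (exchange h (finProdFinEquiv.symm m).1 (finProdFinEquiv.symm m).2)

theorem slope_apply (p : PluckerSpace q n) (i : Fin (q + 2)) (j : Fin (n - q)) :
    slope h p (finProdFinEquiv (i, j)) = coord (exchange h i j) p := by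
  change coord (exchange h (finProdFinEquiv.symm (finProdFinEquiv (i, j))).1
    (finProdFinEquiv.symm (finProdFinEquiv (i, j))).2) p = _
  rw [Equiv.symm_apply_apply]

theorem slope_wedge_graphFrame (X : Model q n) : slope h (wedge (graphFrame h X)) = X := by
  ext m
  obtain ⟨⟨i, j⟩, rfl⟩ := finProdFinEquiv.surjective m
  have hcol : (Matrix.of fun i' l => graphFrame h X i' (exchange h i j l)) =
      (1 : Matrix (Fin (q + 2)) (Fin (q + 2)) ℝ).updateCol i
        fun i' => X (finProdFinEquiv (i', j)) := by
    ext i' l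
    by_cases hl : l = i
    · subst hl
      simp [exchange, graphFrame_inr]
    · simp [exchange, hl, graphFrame_baseEmb, Matrix.one_apply]
  rw [slope_apply, coord_wedge, hcol, ← Matrix.cramer_apply, Matrix.cramer_one]
  rfl

theorem slope_single : slope h (Pi.single (baseEmb h) 1 : PluckerSpace q n) = 0 := by
  rw [← wedge_stdFrame, ← graphFrame_zero, slope_wedge_graphFrame]

/-- The matrices `X` for which the rows of `(1 | X)` span a Lorentzian plane. -/
def graphDomain : Set (Model q n) :=
  {X | ∃ a : Fin (q + 2) → ℝ, minkowskiForm (n + 2) (∑ i, a i • graphFrame h X i)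
    (∑ i, a i • graphFrame h X i) < 0}

theorem mem_graphDomain_iff {X : Model q n} :
    X ∈ graphDomain h ↔ ∃ P : LorentzPlane q n, IsFrame P (graphFrame h X) := by
  refine ⟨fun ⟨a, ha⟩ => ?_, fun ⟨P, hP⟩ => ?_⟩
  · exact exists_isFrame (linearIndependent_graphFrame h X)
      ⟨_, (Submodule.mem_span_range_iff_exists_fun ℝ).2 ⟨a, rfl⟩, ha⟩
  · obtain ⟨v, hv, hneg⟩ := P.exists_timelike
    rw [hP.carrier_eq, Submodule.mem_span_range_iff_exists_fun] at hv
    obtain ⟨a, rfl⟩ := hv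
    exact ⟨a, hneg⟩

variable {h} in
theorem pluckerForm_wedge_graphFrame_pos {X : Model q n} (hX : X ∈ graphDomain h) :
    0 < pluckerForm q n (wedge (graphFrame h X)) (wedge (graphFrame h X)) := by
  obtain ⟨P, hP⟩ := (mem_graphDomain_iff h).1 hX
  exact hP.pluckerForm_pos

variable {h} in
theorem inv_sqrt_pluckerForm_wedge_graphFrame_pos {X : Model q n} (hX : X ∈ graphDomain h) :
    0 < (√(pluckerForm q n (wedge (graphFrame h X)) (wedge (graphFrame h X))))⁻¹ :=
  inv_pos.2 (Real.sqrt_pos.2 (pluckerForm_wedge_graphFrame_pos hX))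

/-- The Plücker vector of the plane spanned by the rows of `(1 | X)`. -/
def graphPlucker (X : Model q n) : PluckerSpace q n := normalize (wedge (graphFrame h X))

theorem graphPlucker_baseEmb_pos {X : Model q n} (hX : X ∈ graphDomain h) :
    0 < graphPlucker h X (baseEmb h) := by
  rw [graphPlucker, normalize, Pi.smul_apply, wedge_graphFrame_baseEmb, smul_eq_mul, mul_one]
  exact inv_sqrt_pluckerForm_wedge_graphFrame_pos hX

theorem graphPlucker_zero : graphPlucker h (0 : Model q n) = Pi.single (baseEmb h) 1 := by
  rw [graphPlucker, graphFrame_zero, normalize, (isPseudoOrthonormal_stdFrame h).pluckerForm_wedge,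
    Real.sqrt_one, inv_one, one_smul, wedge_stdFrame]

/-- The matrix `X` of a plane in terms of any non-zero multiple of its Plücker vector. -/
def graphCoord (p : PluckerSpace q n) : Model q n := (p (baseEmb h))⁻¹ • slope h p

theorem graphCoord_smul {t : ℝ} (ht : t ≠ 0) (p : PluckerSpace q n) :
    graphCoord h (t • p) = graphCoord h p := by
  rw [graphCoord, graphCoord, Pi.smul_apply, map_smul, smul_smul, smul_eq_mul, mul_inv,
    mul_comm t⁻¹, mul_assoc, inv_mul_cancel₀ ht, mul_one]

theorem graphCoord_graphPlucker {X : Model q n} (hX : X ∈ graphDomain h) :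
    graphCoord h (graphPlucker h X) = X := by
  rw [graphPlucker, normalize,
    graphCoord_smul h (inv_sqrt_pluckerForm_wedge_graphFrame_pos hX).ne', graphCoord,
    wedge_graphFrame_baseEmb, inv_one, one_smul, slope_wedge_graphFrame]

theorem IsFrame.exists_isFrame_graphFrame {P : LorentzPlane q n}
    {x : Fin (q + 2) → Fin (n + 2) → ℝ} (hx : IsFrame P x)
    (hpos : 0 < (wedge x : PluckerSpace q n) (baseEmb h)) :
    ∃ X : Model q n, IsFrame P (graphFrame h X) := by
  set T : Matrix (Fin (q + 2)) (Fin (q + 2)) ℝ := Matrix.of fun i l => x i (baseEmb h l) with hT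
  have hinv : 0 < T⁻¹.det := by
    rw [Matrix.det_nonsing_inv, Ring.inverse_eq_inv']
    exact inv_pos.2 hpos
  obtain ⟨X, hX⟩ := exists_eq_graphFrame h (y := fun i => ∑ j, T⁻¹ i j • x j) fun i l => by
    calc (∑ j, T⁻¹ i j • x j) (baseEmb h l) = (T⁻¹ * T) i l := by simp [hT, Matrix.mul_apply]
      _ = if i = l then 1 else 0 := by
        rw [Matrix.nonsing_inv_mul T hpos.ne'.isUnit, Matrix.one_apply]
  exact ⟨X, hX ▸ hx.matrix_mul hinv⟩

theorem LorentzPlane.isFrame_graphFrame {P : LorentzPlane q n} (hP : 0 < P.plucker (baseEmb h)) :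
    IsFrame P (graphFrame h (graphCoord h P.plucker)) := by
  have hx := P.isFrame_someBasis
  have hpos : 0 < (wedge _ : PluckerSpace q n) (baseEmb h) :=
    pos_of_mul_pos_right (hx.plucker_eq ▸ hP) (inv_nonneg.2 (Real.sqrt_nonneg _))
  obtain ⟨X, hX⟩ := hx.exists_isFrame_graphFrame h hpos
  rwa [hX.plucker_eq, ← graphPlucker,
    graphCoord_graphPlucker h ((mem_graphDomain_iff h).2 ⟨P, hX⟩)]

theorem LorentzPlane.plucker_basePlane :
    (basePlane h : LorentzPlane q n).plucker = Pi.single (baseEmb h) 1 := by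
  rw [(isFrame_basePlane h).plucker_eq, ← graphPlucker_zero, graphPlucker, graphFrame_zero]

end Graph

theorem LorentzPlane.plucker_injective {q n : ℕ} (h : q < n) :
    Function.Injective (plucker : LorentzPlane q n → PluckerSpace q n) := by
  intro P P' hPP'
  obtain ⟨A, rfl⟩ := P.exists_smul_basePlane h
  have heq : (basePlane h.le : LorentzPlane q n).plucker = (A⁻¹ • P').plucker := by
    rw [plucker_smul, ← hPP', ← plucker_smul, inv_smul_smul]
  have hpos : 0 < (basePlane h.le : LorentzPlane q n).plucker (baseEmb h.le) := by
    rw [plucker_basePlane, Pi.single_eq_same]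
    exact one_pos
  have hbase := isFrame_graphFrame h.le hpos
  have himage := isFrame_graphFrame h.le (heq ▸ hpos)
  rw [← heq] at himage
  rw [hbase.unique himage, smul_inv_smul]

/-! ### Smoothness -/

section Smoothness

variable {q n : ℕ} {m : WithTop ℕ∞} {E : Type*} [NormedAddCommGroup E] [NormedSpace ℝ E]

theorem contDiff_wedge {f : E → Fin (q + 2) → Fin (n + 2) → ℝ}
    (hf : ∀ i k, ContDiff ℝ m fun t => f t i k) :
    ContDiff ℝ m fun t => (wedge (f t) : PluckerSpace q n) := by
  rw [contDiff_pi]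
  intro I
  simp only [wedge, Matrix.det_apply]
  exact ContDiff.sum fun σ _ => (contDiff_prod fun i _ => hf _ _).const_smul _

theorem contDiff_compound {A : E → Matrix (Fin (n + 2)) (Fin (n + 2)) ℝ} {p : E → PluckerSpace q n}
    (hA : ∀ i j, ContDiff ℝ m fun t => A t i j) (hp : ContDiff ℝ m p) :
    ContDiff ℝ m fun t => compound (A t) (p t) := by
  rw [contDiff_pi]
  intro J
  simp only [compound_apply, Matrix.det_apply]
  refine ContDiff.sum fun I _ => (contDiff_pi.1 hp I).mul (ContDiff.sum fun σ _ => ?_)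
  exact (contDiff_prod fun i _ => hA _ _).const_smul _

theorem contDiff_compound_const (A : Matrix (Fin (n + 2)) (Fin (n + 2)) ℝ) :
    ContDiff ℝ m (compound A : PluckerSpace q n → PluckerSpace q n) :=
  contDiff_compound (fun _ _ => contDiff_const) contDiff_id

theorem contDiff_bilinForm {V : Type*} [NormedAddCommGroup V] [NormedSpace ℝ V]
    [FiniteDimensional ℝ V] (B : LinearMap.BilinForm ℝ V) {f g : E → V} (hf : ContDiff ℝ m f)
    (hg : ContDiff ℝ m g) : ContDiff ℝ m fun t => B (f t) (g t) :=
  (B.toContinuousBilinearMap.contDiff.comp hf).clm_apply hg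

variable (h : q ≤ n)

theorem contDiff_graphFrame (i : Fin (q + 2)) (k : Fin (n + 2)) :
    ContDiff ℝ m fun X : Model q n => graphFrame h X i k := by
  obtain ⟨k | k, rfl⟩ := (blockIndex h).surjective k
  · simp only [blockIndex_inl, graphFrame_baseEmb]
    exact contDiff_const
  · simp only [graphFrame_inr]
    fun_prop

theorem contDiff_wedge_graphFrame :
    ContDiff ℝ m fun X : Model q n => (wedge (graphFrame h X) : PluckerSpace q n) :=
  contDiff_wedge fun i k => contDiff_graphFrame h i k

theorem isOpen_graphDomain : IsOpen (graphDomain h : Set (Model q n)) := by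
  have hunion : (graphDomain h : Set (Model q n)) = ⋃ a : Fin (q + 2) → ℝ,
      {X | minkowskiForm (n + 2) (∑ i, a i • graphFrame h X i)
        (∑ i, a i • graphFrame h X i) < 0} := by
    ext X
    simp [graphDomain]
  rw [hunion]
  refine isOpen_iUnion fun a => isOpen_lt ?_ continuous_const
  have hf : ContDiff ℝ 0 fun X : Model q n => ∑ i, a i • graphFrame h X i :=
    ContDiff.sum fun i _ => (contDiff_pi.2 fun k => contDiff_graphFrame h i k).const_smul (a i)
  exact (contDiff_bilinForm _ hf hf).continuous

theorem contDiffOn_graphPlucker :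
    ContDiffOn ℝ m (graphPlucker h) (graphDomain h : Set (Model q n)) := by
  have hw := contDiff_wedge_graphFrame (m := m) h
  have hsqrt := (contDiff_bilinForm (pluckerForm q n) hw hw).contDiffOn.sqrt
    fun X hX => (pluckerForm_wedge_graphFrame_pos hX).ne'
  exact (hsqrt.inv fun X hX => (Real.sqrt_pos.2 (pluckerForm_wedge_graphFrame_pos hX)).ne').smul
    hw.contDiffOn

theorem contDiffOn_graphCoord :
    ContDiffOn ℝ m (graphCoord h) {p : PluckerSpace q n | 0 < p (baseEmb h)} :=
  ((contDiff_apply ℝ ℝ _).contDiffOn.inv fun p hp => (show 0 < p (baseEmb h) from hp).ne').smul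
    (LinearMap.toContinuousLinearMap (slope h)).contDiff.contDiffOn

end Smoothness

/-! ### The manifold of spheres -/

/-- Oriented spheres correspond to oriented planes. -/
def planeEquiv (q n : ℕ) : OrientedSphere q n ≃ LorentzPlane q n :=
  Equiv.ofBijective _ OrientedSphere.toPlane_bijective

theorem toPlane_planeEquiv_symm {q n : ℕ} (P : LorentzPlane q n) :
    ((planeEquiv q n).symm P).toPlane = P :=
  (planeEquiv q n).apply_symm_apply P

instance {q n : ℕ} : MulAction (SOLorentz (n + 2)) (OrientedSphere q n) :=
  (planeEquiv q n).mulAction (SOLorentz (n + 2))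

instance {q n : ℕ} : TopologicalSpace (OrientedSphere q n) :=
  TopologicalSpace.induced OrientedSphere.plucker inferInstance

namespace OrientedSphere

variable {q n : ℕ}

theorem toPlane_smul (A : SOLorentz (n + 2)) (S : OrientedSphere q n) :
    (A • S).toPlane = A • S.toPlane :=
  toPlane_planeEquiv_symm _

theorem plucker_smul (A : SOLorentz (n + 2)) (S : OrientedSphere q n) :
    (A • S).plucker = compound (A : GL (Fin (n + 2)) ℝ) S.plucker := by
  rw [plucker, toPlane_smul, LorentzPlane.plucker_smul, plucker]

theorem plucker_injective (h : q < n) :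
    Function.Injective (plucker : OrientedSphere q n → PluckerSpace q n) :=
  (LorentzPlane.plucker_injective h).comp toPlane_injective

theorem isInducing_plucker :
    Topology.IsInducing (plucker : OrientedSphere q n → PluckerSpace q n) := ⟨rfl⟩

theorem isEmbedding_plucker (h : q < n) :
    Topology.IsEmbedding (plucker : OrientedSphere q n → PluckerSpace q n) :=
  ⟨isInducing_plucker, plucker_injective h⟩

theorem continuous_plucker :
    Continuous (plucker : OrientedSphere q n → PluckerSpace q n) :=
  isInducing_plucker.continuous

end OrientedSphere

theorem continuous_compound {q n : ℕ} {X : Type*} [TopologicalSpace X]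
    {A : X → Matrix (Fin (n + 2)) (Fin (n + 2)) ℝ} {p : X → PluckerSpace q n}
    (hA : Continuous A) (hp : Continuous p) : Continuous fun t => compound (A t) (p t) := by
  refine continuous_pi fun J => ?_
  simp only [compound_apply]
  exact continuous_finsetSum _ fun I _ =>
    ((continuous_apply I).comp hp).mul (hA.matrix_submatrix _ _).matrix_det

instance {q n : ℕ} : ContinuousSMul (SOLorentz (n + 2)) (OrientedSphere q n) where
  continuous_smul := by
    rw [OrientedSphere.isInducing_plucker.continuous_iff]
    have hsmul : OrientedSphere.plucker ∘
        (fun p : SOLorentz (n + 2) × OrientedSphere q n => p.1 • p.2) =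
        fun p => compound ((p.1 : GL (Fin (n + 2)) ℝ) : Matrix _ _ ℝ) p.2.plucker :=
      funext fun p => OrientedSphere.plucker_smul _ _
    rw [hsmul]
    exact continuous_compound
      (Units.continuous_val.comp (continuous_subtype_val.comp continuous_fst))
      (OrientedSphere.continuous_plucker.comp continuous_snd)

/-- The sphere that spans the first `q + 2` basis vectors. -/
def baseSphere {q n : ℕ} (h : q ≤ n) : OrientedSphere q n := (planeEquiv q n).symm (basePlane h)

theorem toPlane_baseSphere {q n : ℕ} (h : q ≤ n) :
    (baseSphere h : OrientedSphere q n).toPlane = basePlane h :=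
  toPlane_planeEquiv_symm _

theorem plucker_baseSphere {q n : ℕ} (h : q ≤ n) :
    (baseSphere h : OrientedSphere q n).plucker = Pi.single (baseEmb h) 1 := by
  rw [OrientedSphere.plucker, toPlane_baseSphere, LorentzPlane.plucker_basePlane]

theorem OrientedSphere.exists_smul_baseSphere {q n : ℕ} (h : q < n) (S : OrientedSphere q n) :
    ∃ A : SOLorentz (n + 2), A • baseSphere h.le = S := by
  obtain ⟨A, hA⟩ := S.toPlane.exists_smul_basePlane h
  exact ⟨A, toPlane_injective (by rw [toPlane_smul, toPlane_baseSphere, hA])⟩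

open Classical in
/-- The sphere whose plane is spanned by the rows of `(1 | X)`. Outside of `graphDomain` its value
is irrelevant. -/
def graphSphere {q n : ℕ} (h : q ≤ n) (X : Model q n) : OrientedSphere q n :=
  if hX : X ∈ graphDomain h then (planeEquiv q n).symm ((mem_graphDomain_iff h).1 hX).choose
  else baseSphere h

section Chart

variable {q n : ℕ} (h : q ≤ n)

theorem isFrame_graphSphere {X : Model q n} (hX : X ∈ graphDomain h) :
    IsFrame (graphSphere h X).toPlane (graphFrame h X) := by
  rw [graphSphere, dif_pos hX, toPlane_planeEquiv_symm]
  exact ((mem_graphDomain_iff h).1 hX).choose_spec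

theorem plucker_graphSphere {X : Model q n} (hX : X ∈ graphDomain h) :
    (graphSphere h X).plucker = graphPlucker h X :=
  (isFrame_graphSphere h hX).plucker_eq

theorem isFrame_basePlane_graphFrame_zero : IsFrame (basePlane h) (graphFrame h 0) := by
  rw [graphFrame_zero]
  exact isFrame_basePlane h

theorem zero_mem_graphDomain : (0 : Model q n) ∈ graphDomain h :=
  (mem_graphDomain_iff h).2 ⟨_, isFrame_basePlane_graphFrame_zero h⟩

theorem graphSphere_zero : graphSphere h (0 : Model q n) = baseSphere h := by
  apply OrientedSphere.toPlane_injective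
  rw [toPlane_baseSphere]
  exact (isFrame_graphSphere h (zero_mem_graphDomain h)).unique
    (isFrame_basePlane_graphFrame_zero h)

/-- The chart around the base sphere that describes a plane as the graph of a linear map. -/
def baseChart : OpenPartialHomeomorph (OrientedSphere q n) (Model q n) where
  toFun S := graphCoord h S.plucker
  invFun := graphSphere h
  source := {S | 0 < S.plucker (baseEmb h)}
  target := graphDomain h
  map_source' S hS := (mem_graphDomain_iff h).2 ⟨_, LorentzPlane.isFrame_graphFrame h hS⟩
  map_target' X hX := by
    rw [Set.mem_ofPred_eq, plucker_graphSphere h hX]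
    exact graphPlucker_baseEmb_pos h hX
  left_inv' S hS := by
    have hf := LorentzPlane.isFrame_graphFrame h (P := S.toPlane) hS
    exact OrientedSphere.toPlane_injective
      ((isFrame_graphSphere h ((mem_graphDomain_iff h).2 ⟨_, hf⟩)).unique hf)
  right_inv' X hX := by
    rw [plucker_graphSphere h hX, graphCoord_graphPlucker h hX]
  open_source := isOpen_lt continuous_const
    ((continuous_apply _).comp OrientedSphere.continuous_plucker)
  open_target := isOpen_graphDomain h
  continuousOn_toFun := (contDiffOn_graphCoord (m := 0) h).continuousOn.comp
    OrientedSphere.continuous_plucker.continuousOn fun S hS => hS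
  continuousOn_invFun := by
    rw [OrientedSphere.isInducing_plucker.continuousOn_iff]
    exact (contDiffOn_graphPlucker (m := 0) h).continuousOn.congr
      fun X hX => plucker_graphSphere h hX

/-- The translate of the base chart by `A`. -/
def chart (A : SOLorentz (n + 2)) : OpenPartialHomeomorph (OrientedSphere q n) (Model q n) :=
  (Homeomorph.smul A).symm.transOpenPartialHomeomorph (baseChart h)

theorem chart_apply (A : SOLorentz (n + 2)) (S : OrientedSphere q n) :
    chart h A S = graphCoord h (A⁻¹ • S).plucker := rfl

theorem chart_symm_apply (A : SOLorentz (n + 2)) (X : Model q n) :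
    (chart h A).symm X = A • graphSphere h X := rfl

theorem chart_target (A : SOLorentz (n + 2)) :
    (chart h A).target = (graphDomain h : Set (Model q n)) := rfl

theorem mem_chart_source_iff (A : SOLorentz (n + 2)) (S : OrientedSphere q n) :
    S ∈ (chart h A).source ↔ 0 < (A⁻¹ • S).plucker (baseEmb h) := Iff.rfl

theorem plucker_inv_smul_chart_symm (A B : SOLorentz (n + 2)) {X : Model q n}
    (hX : X ∈ graphDomain h) : (B⁻¹ • (chart h A).symm X).plucker =
      compound ((B⁻¹ * A : SOLorentz (n + 2)) : GL (Fin (n + 2)) ℝ) (graphPlucker h X) := by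
  rw [chart_symm_apply, smul_smul, OrientedSphere.plucker_smul, plucker_graphSphere h hX]

theorem mem_chart_transition_source {A B : SOLorentz (n + 2)} {X : Model q n}
    (hX : X ∈ ((chart (q := q) h A).symm ≫ₕ chart h B).source) :
    X ∈ graphDomain h ∧ 0 < compound ((B⁻¹ * A : SOLorentz (n + 2)) : GL (Fin (n + 2)) ℝ)
      (graphPlucker h X) (baseEmb h) := by
  rw [OpenPartialHomeomorph.trans_source, OpenPartialHomeomorph.symm_source, chart_target,
    Set.mem_inter_iff, Set.mem_preimage, mem_chart_source_iff] at hX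
  rwa [plucker_inv_smul_chart_symm h A B hX.1] at hX

theorem contDiffOn_transition {m : WithTop ℕ∞} (A B : SOLorentz (n + 2)) :
    ContDiffOn ℝ m (chart h B ∘ (chart h A).symm)
      ((chart (q := q) h A).symm ≫ₕ chart h B).source := by
  have hcoord : ContDiffOn ℝ m (fun X : Model q n => graphCoord h
      (compound ((B⁻¹ * A : SOLorentz (n + 2)) : GL (Fin (n + 2)) ℝ) (graphPlucker h X)))
      ((chart (q := q) h A).symm ≫ₕ chart h B).source :=
    (contDiffOn_graphCoord h).comp ((contDiff_compound_const _).comp_contDiffOn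
      ((contDiffOn_graphPlucker h).mono fun X hX => (mem_chart_transition_source h hX).1))
      fun X hX => (mem_chart_transition_source h hX).2
  refine hcoord.congr fun X hX => ?_
  rw [Function.comp_apply, chart_apply,
    plucker_inv_smul_chart_symm h A B (mem_chart_transition_source h hX).1]

end Chart

section Manifold

variable {q n : ℕ} [hq : Fact (q < n)]

/-- An element of `SO(n + 1, 1)` that moves the base sphere to `S`. -/
def mover (S : OrientedSphere q n) : SOLorentz (n + 2) :=
  (S.exists_smul_baseSphere hq.out).choose

theorem mover_smul (S : OrientedSphere q n) : mover S • baseSphere hq.out.le = S :=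
  (S.exists_smul_baseSphere hq.out).choose_spec

instance : ChartedSpace (Model q n) (OrientedSphere q n) where
  atlas := Set.range (chart hq.out.le)
  chartAt S := chart hq.out.le (mover S)
  mem_chart_source S := by
    rw [mem_chart_source_iff, inv_smul_eq_iff.2 (mover_smul S).symm, plucker_baseSphere,
      Pi.single_eq_same]
    exact one_pos
  chart_mem_atlas S := ⟨_, rfl⟩

instance : IsManifold (𝓡 ((q + 2) * (n - q))) ∞ (OrientedSphere q n) := by
  apply isManifold_of_contDiffOn
  rintro _ _ ⟨A, rfl⟩ ⟨B, rfl⟩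
  simp only [modelWithCornersSelf_coe, modelWithCornersSelf_coe_symm, Set.range_id, Set.inter_univ,
    Set.preimage_id, Function.comp_id, Function.id_comp, OpenPartialHomeomorph.coe_trans]
  exact contDiffOn_transition hq.out.le A B

theorem chart_mem_maximalAtlas (A : SOLorentz (n + 2)) :
    chart hq.out.le A ∈
      IsManifold.maximalAtlas (𝓡 ((q + 2) * (n - q))) ∞ (OrientedSphere q n) :=
  IsManifold.subset_maximalAtlas ⟨A, rfl⟩

end Manifold

/-! ### The Plücker embedding -/

theorem mem_contDiffGroupoid_of_contDiffOn {V : Type*} [NormedAddCommGroup V] [NormedSpace ℝ V]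
    {m : WithTop ℕ∞} {e : OpenPartialHomeomorph V V} (he : ContDiffOn ℝ m e e.source)
    (hsymm : ContDiffOn ℝ m e.symm e.target) : e ∈ contDiffGroupoid m 𝓘(ℝ, V) := by
  rw [contDiffGroupoid, mem_groupoid_of_pregroupoid, contDiffPregroupoid]
  simp only [modelWithCornersSelf_coe, modelWithCornersSelf_coe_symm, Set.range_id, Set.inter_univ,
    Set.preimage_id, Function.comp_id, Function.id_comp]
  exact ⟨he, hsymm⟩

section FiberTranslation

variable {E V : Type*} [NormedAddCommGroup E] [NormedSpace ℝ E] [NormedAddCommGroup V]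
  [NormedSpace ℝ V] (ρ : V →L[ℝ] E) {U : Set E} {δ : E → V}

/-- Translation of the fibre of `ρ` over `X ∈ U` by the vector `-δ X` in the kernel of `ρ`. It
straightens graphs over `U`. -/
def fiberTranslation (hU : IsOpen U) (hδ : ContinuousOn δ U) (hker : ∀ X ∈ U, ρ (δ X) = 0) :
    OpenPartialHomeomorph V V where
  toFun y := y - δ (ρ y)
  invFun y := y + δ (ρ y)
  source := ρ ⁻¹' U
  target := ρ ⁻¹' U
  map_source' y hy := by rwa [Set.mem_preimage, map_sub, hker _ hy, sub_zero]
  map_target' y hy := by rwa [Set.mem_preimage, map_add, hker _ hy, add_zero]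
  left_inv' y hy := by rw [map_sub, hker _ hy, sub_zero, sub_add_cancel]
  right_inv' y hy := by rw [map_add, hker _ hy, add_zero, add_sub_cancel_right]
  open_source := hU.preimage ρ.continuous
  open_target := hU.preimage ρ.continuous
  continuousOn_toFun := continuousOn_id.sub (hδ.comp ρ.continuous.continuousOn fun _ hy => hy)
  continuousOn_invFun := continuousOn_id.add (hδ.comp ρ.continuous.continuousOn fun _ hy => hy)

theorem fiberTranslation_mem_contDiffGroupoid {m : WithTop ℕ∞} (hU : IsOpen U)
    (hδ : ContDiffOn ℝ m δ U) (hker : ∀ X ∈ U, ρ (δ X) = 0) :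
    fiberTranslation ρ hU hδ.continuousOn hker ∈ contDiffGroupoid m 𝓘(ℝ, V) := by
  have hcomp : ContDiffOn ℝ m (fun y => δ (ρ y)) (ρ ⁻¹' U) :=
    hδ.comp ρ.contDiff.contDiffOn fun _ hy => hy
  exact mem_contDiffGroupoid_of_contDiffOn (contDiffOn_id.sub hcomp) (contDiffOn_id.add hcomp)

end FiberTranslation

section Dehomogenize

variable {ι : Type*} [DecidableEq ι] (b : ι)

/-- The change of coordinates that divides all coordinates by the `b`-th one, which is kept. -/
def dehomogenize : OpenPartialHomeomorph (ι → ℝ) (ι → ℝ) where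
  toFun p := (p b)⁻¹ • p + (p b - 1) • Pi.single b 1
  invFun y := y b • y + (y b - y b * y b) • Pi.single b 1
  source := {p | 0 < p b}
  target := {y | 0 < y b}
  map_source' p hp := by
    simpa [inv_mul_cancel₀ (show 0 < p b from hp).ne'] using hp
  map_target' y hy := by simpa using hy
  left_inv' p hp := by
    have hb : p b ≠ 0 := (show 0 < p b from hp).ne'
    funext i
    by_cases hi : i = b
    · subst hi
      simp only [Pi.add_apply, Pi.smul_apply, smul_eq_mul, Pi.single_eq_same, inv_mul_cancel₀ hb]
      ring
    · simp [hb, hi]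
  right_inv' y hy := by
    have hb : y b ≠ 0 := (show 0 < y b from hy).ne'
    funext i
    by_cases hi : i = b
    · subst hi
      simp only [Pi.add_apply, Pi.smul_apply, smul_eq_mul, Pi.single_eq_same]
      field_simp
      ring
    · simp [hb, hi]
  open_source := isOpen_lt continuous_const (continuous_apply b)
  open_target := isOpen_lt continuous_const (continuous_apply b)
  continuousOn_toFun :=
    (((continuous_apply b).continuousOn.inv₀ fun p hp => (show 0 < p b from hp).ne').smul
      continuousOn_id).add (Continuous.continuousOn (by fun_prop))
  continuousOn_invFun := by fun_prop

theorem dehomogenize_apply (p : ι → ℝ) :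
    dehomogenize b p = (p b)⁻¹ • p + (p b - 1) • Pi.single b 1 := rfl

variable [Fintype ι]

theorem contDiffOn_dehomogenize {m : WithTop ℕ∞} :
    ContDiffOn ℝ m (dehomogenize b) (dehomogenize b).source := by
  have hb : ContDiffOn ℝ m (fun p : ι → ℝ => p b) (dehomogenize b).source :=
    (contDiff_apply ℝ ℝ b).contDiffOn
  exact ((hb.inv fun p hp => (show 0 < p b from hp).ne').smul contDiffOn_id).add
    ((hb.sub contDiffOn_const).smul contDiffOn_const)

theorem dehomogenize_mem_contDiffGroupoid {m : WithTop ℕ∞} :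
    dehomogenize b ∈ contDiffGroupoid m 𝓘(ℝ, ι → ℝ) := by
  have hb : ContDiff ℝ m fun y : ι → ℝ => y b := contDiff_apply ℝ ℝ b
  exact mem_contDiffGroupoid_of_contDiffOn (contDiffOn_dehomogenize b)
    ((hb.smul contDiff_id).add ((hb.sub (hb.mul hb)).smul contDiff_const)).contDiffOn

end Dehomogenize

theorem toOpenPartialHomeomorph_mem_contDiffGroupoid {V : Type*} [NormedAddCommGroup V]
    [NormedSpace ℝ V] {m : WithTop ℕ∞} (e : V ≃L[ℝ] V) :
    e.toHomeomorph.toOpenPartialHomeomorph ∈ contDiffGroupoid m 𝓘(ℝ, V) :=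
  mem_contDiffGroupoid_of_contDiffOn e.contDiff.contDiffOn e.symm.contDiff.contDiffOn

/-- The action of `SO(n + 1, 1)` on the exterior power. -/
def compoundEquiv {q n : ℕ} (A : SOLorentz (n + 2)) : PluckerSpace q n ≃L[ℝ] PluckerSpace q n :=
  (LinearEquiv.ofLinearMap (compound (A : GL (Fin (n + 2)) ℝ))
    (compound ((A⁻¹ : SOLorentz (n + 2)) : GL (Fin (n + 2)) ℝ))
    (by rw [← compound_mul, ← Units.val_mul, ← Subgroup.coe_mul, mul_inv_cancel, Subgroup.coe_one,
      Units.val_one, compound_one])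
    (by rw [← compound_mul, ← Units.val_mul, ← Subgroup.coe_mul, inv_mul_cancel, Subgroup.coe_one,
      Units.val_one, compound_one])).toContinuousLinearEquiv

theorem compoundEquiv_symm_plucker_smul {q n : ℕ} (A : SOLorentz (n + 2))
    (S : OrientedSphere q n) : (compoundEquiv A).symm (A • S).plucker = S.plucker := by
  rw [ContinuousLinearEquiv.symm_apply_eq, OrientedSphere.plucker_smul]
  rfl

section AmbientChart

variable {q n : ℕ} (h : q ≤ n)

theorem exists_rightInverse_slope : ∃ L : Model q n →ₗ[ℝ] PluckerSpace q n,
    slope h ∘ₗ L = LinearMap.id :=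
  LinearMap.exists_rightInverse_of_surjective _
    (LinearMap.range_eq_top.2 fun X => ⟨_, slope_wedge_graphFrame h X⟩)

/-- A linear section of `slope`. -/
def slopeSection : Model q n →L[ℝ] PluckerSpace q n :=
  LinearMap.toContinuousLinearMap (exists_rightInverse_slope h).choose

theorem slope_slopeSection (X : Model q n) : slope h (slopeSection h X) = X :=
  LinearMap.congr_fun (exists_rightInverse_slope h).choose_spec X

theorem slope_dehomogenize (p : PluckerSpace q n) :
    slope h (dehomogenize (baseEmb h) p) = graphCoord h p := by
  rw [dehomogenize_apply, map_add, map_smul, map_smul, slope_single, smul_zero, add_zero,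
    graphCoord]

/-- The difference between the image of the base chart, in the coordinates `dehomogenize`, and a
linear subspace. -/
def graphDeviation (X : Model q n) : PluckerSpace q n :=
  dehomogenize (baseEmb h) (graphPlucker h X) - slopeSection h X

theorem slope_graphDeviation {X : Model q n} (hX : X ∈ graphDomain h) :
    slope h (graphDeviation h X) = 0 := by
  rw [graphDeviation, map_sub, slope_dehomogenize, graphCoord_graphPlucker h hX,
    slope_slopeSection, sub_self]

theorem contDiffOn_graphDeviation {m : WithTop ℕ∞} :
    ContDiffOn ℝ m (graphDeviation h) (graphDomain h : Set (Model q n)) :=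
  ((contDiffOn_dehomogenize _).comp (contDiffOn_graphPlucker h)
    fun _ hX => graphPlucker_baseEmb_pos h hX).sub (slopeSection h).contDiff.contDiffOn

/-- A diffeomorphism that takes the image of the base chart to a linear subspace. -/
def straightening : OpenPartialHomeomorph (PluckerSpace q n) (PluckerSpace q n) :=
  dehomogenize (baseEmb h) ≫ₕ fiberTranslation (LinearMap.toContinuousLinearMap (slope h))
    (isOpen_graphDomain h) (contDiffOn_graphDeviation (m := ∞) h).continuousOn
    fun _ hX => slope_graphDeviation h hX

theorem graphPlucker_mem_straightening_source {X : Model q n} (hX : X ∈ graphDomain h) :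
    graphPlucker h X ∈ (straightening h).source := by
  refine ⟨graphPlucker_baseEmb_pos h hX, ?_⟩
  change slope h (dehomogenize (baseEmb h) (graphPlucker h X)) ∈ graphDomain h
  rwa [slope_dehomogenize, graphCoord_graphPlucker h hX]

theorem straightening_graphPlucker {X : Model q n} (hX : X ∈ graphDomain h) :
    straightening h (graphPlucker h X) = slopeSection h X := by
  change dehomogenize (baseEmb h) (graphPlucker h X) -
    graphDeviation h (slope h (dehomogenize (baseEmb h) (graphPlucker h X))) = _
  rw [slope_dehomogenize, graphCoord_graphPlucker h hX, graphDeviation, sub_sub_cancel]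

theorem straightening_mem_contDiffGroupoid :
    straightening h ∈ contDiffGroupoid ∞ 𝓘(ℝ, PluckerSpace q n) :=
  StructureGroupoid.trans _ (dehomogenize_mem_contDiffGroupoid _)
    (fiberTranslation_mem_contDiffGroupoid _ _ (contDiffOn_graphDeviation h) _)

/-- A chart of the exterior power in which the image of `chart h A` is linear. -/
def ambientChart (A : SOLorentz (n + 2)) :
    OpenPartialHomeomorph (PluckerSpace q n) (PluckerSpace q n) :=
  (compoundEquiv A).symm.toHomeomorph.toOpenPartialHomeomorph ≫ₕ straightening h

theorem ambientChart_mem_maximalAtlas (A : SOLorentz (n + 2)) :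
    ambientChart h A ∈ IsManifold.maximalAtlas 𝓘(ℝ, PluckerSpace q n) ∞ (PluckerSpace q n) :=
  StructureGroupoid.mem_maximalAtlas_of_mem_groupoid _
    (StructureGroupoid.trans _ (toOpenPartialHomeomorph_mem_contDiffGroupoid _)
      (straightening_mem_contDiffGroupoid h))

theorem plucker_smul_graphSphere_mem_ambientChart_source (A : SOLorentz (n + 2)) {X : Model q n}
    (hX : X ∈ graphDomain h) : (A • graphSphere h X).plucker ∈ (ambientChart h A).source := by
  refine ⟨trivial, ?_⟩
  change (compoundEquiv A).symm (A • graphSphere h X).plucker ∈ (straightening h).source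
  rw [compoundEquiv_symm_plucker_smul, plucker_graphSphere h hX]
  exact graphPlucker_mem_straightening_source h hX

theorem ambientChart_plucker_smul_graphSphere (A : SOLorentz (n + 2)) {X : Model q n}
    (hX : X ∈ graphDomain h) :
    ambientChart h A (A • graphSphere h X).plucker = slopeSection h X := by
  change straightening h ((compoundEquiv A).symm (A • graphSphere h X).plucker) = _
  rw [compoundEquiv_symm_plucker_smul, plucker_graphSphere h hX, straightening_graphPlucker h hX]

end AmbientChart

section Embedding

variable {q n : ℕ} [hq : Fact (q < n)]

theorem isImmersion_plucker : Manifold.IsImmersion (𝓡 ((q + 2) * (n - q)))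
    𝓘(ℝ, PluckerSpace q n) ∞ (OrientedSphere.plucker : OrientedSphere q n → PluckerSpace q n) := by
  have h := hq.out.le
  have hright : Function.RightInverse (slopeSection (q := q) h)
      (LinearMap.toContinuousLinearMap (slope h)) := slope_slopeSection h
  refine ⟨_, inferInstance, inferInstance, fun S =>
    Manifold.IsImmersionAtOfComplement.mk_of_continuousAt
      OrientedSphere.continuous_plucker.continuousAt
      (ContinuousLinearEquiv.equivOfRightInverse (LinearMap.toContinuousLinearMap (slope h))
        (slopeSection h) hright).symm
      (chart h (mover S)) (ambientChart h (mover S)) (mem_chart_source (Model q n) S) ?_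
      (chart_mem_maximalAtlas _) (ambientChart_mem_maximalAtlas h _) ?_⟩
  · have hS := plucker_smul_graphSphere_mem_ambientChart_source h (mover S) (zero_mem_graphDomain h)
    rwa [graphSphere_zero, mover_smul] at hS
  · intro X hX
    rw [OpenPartialHomeomorph.extend_target, modelWithCornersSelf_coe_symm, Set.preimage_id,
      modelWithCornersSelf_coe, Set.range_id, Set.inter_univ, chart_target] at hX
    simp only [OpenPartialHomeomorph.extend_coe, OpenPartialHomeomorph.extend_coe_symm,
      Function.comp_apply, modelWithCornersSelf_coe, modelWithCornersSelf_coe_symm, id_eq,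
      chart_symm_apply]
    rw [ambientChart_plucker_smul_graphSphere h _ hX,
      ContinuousLinearEquiv.equivOfRightInverse_symm_apply]
    simp

theorem isSmoothEmbedding_plucker : Manifold.IsSmoothEmbedding (𝓡 ((q + 2) * (n - q)))
    𝓘(ℝ, PluckerSpace q n) ∞ (OrientedSphere.plucker : OrientedSphere q n → PluckerSpace q n) :=
  ⟨isImmersion_plucker, OrientedSphere.isEmbedding_plucker hq.out⟩

theorem contMDiff_plucker : ContMDiff (𝓡 ((q + 2) * (n - q))) 𝓘(ℝ, PluckerSpace q n) ∞
    (OrientedSphere.plucker : OrientedSphere q n → PluckerSpace q n) :=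
  isSmoothEmbedding_plucker.contMDiff

theorem isSmoothMatrixAction_orientedSphere :
    IsSmoothMatrixAction (𝓡 ((q + 2) * (n - q))) (OrientedSphere q n) (SOLorentz (n + 2)) := by
  intro k A p hA hp
  have hsmul : OrientedSphere.plucker ∘ (fun t => A t • p t) =
      fun t => compound ((A t : GL (Fin (n + 2)) ℝ) : Matrix _ _ ℝ) (p t).plucker :=
    funext fun t => OrientedSphere.plucker_smul _ _
  have hcompound : ContDiff ℝ ∞ fun t =>
      compound ((A t : GL (Fin (n + 2)) ℝ) : Matrix _ _ ℝ) (p t).plucker :=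
    contDiff_compound hA (contMDiff_iff_contDiff.1 (contMDiff_plucker.comp hp))
  rw [ContMDiff.iff_comp_isImmersion isImmersion_plucker,
    OrientedSphere.isInducing_plucker.continuous_iff, hsmul]
  exact ⟨hcompound.continuous, hcompound.contMDiff⟩

theorem contMDiff_smul_orientedSphere (A : SOLorentz (n + 2)) :
    ContMDiff (𝓡 ((q + 2) * (n - q))) (𝓡 ((q + 2) * (n - q))) ∞
      fun S : OrientedSphere q n => A • S := by
  have hsmul : OrientedSphere.plucker ∘ (fun S : OrientedSphere q n => A • S) =
      compound (A : GL (Fin (n + 2)) ℝ) ∘ OrientedSphere.plucker :=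
    funext fun t => OrientedSphere.plucker_smul _ _
  rw [ContMDiff.iff_comp_isImmersion isImmersion_plucker, hsmul]
  exact ⟨continuous_const_smul A, (contDiff_compound_const _).contMDiff.comp contMDiff_plucker⟩

end Embedding

/-! ### The isotropy group of the base sphere -/

section Isotropy

variable {q n : ℕ} (h : q ≤ n)

/-- The matrix `A` in block form. -/
def blocks (A : Matrix (Fin (n + 2)) (Fin (n + 2)) ℝ) :
    Matrix (Fin (q + 2) ⊕ Fin (n - q)) (Fin (q + 2) ⊕ Fin (n - q)) ℝ :=
  A.submatrix (blockIndex h) (blockIndex h)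

theorem blocks_eq_iff {A : Matrix (Fin (n + 2)) (Fin (n + 2)) ℝ}
    {M : Matrix (Fin (q + 2) ⊕ Fin (n - q)) (Fin (q + 2) ⊕ Fin (n - q)) ℝ} :
    blocks h A = M ↔ M.submatrix (blockIndex h).symm (blockIndex h).symm = A :=
  (Matrix.reindex (blockIndex h).symm (blockIndex h).symm).eq_symm_apply.symm.trans eq_comm

theorem blocks_minkowskiMatrix : blocks h (minkowskiMatrix (n + 2)) =
    Matrix.fromBlocks (minkowskiMatrix (q + 2)) 0 0 (1 : Matrix (Fin (n - q)) (Fin (n - q)) ℝ) :=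
  (blocks_eq_iff h).2 (minkowskiMatrix_eq_blocks h).symm

theorem det_blocks (A : Matrix (Fin (n + 2)) (Fin (n + 2)) ℝ) : (blocks h A).det = A.det :=
  Matrix.det_submatrix_equiv_self _ _

theorem transpose_blocks_mul_mul (A J : Matrix (Fin (n + 2)) (Fin (n + 2)) ℝ) :
    (blocks h A)ᵀ * blocks h J * blocks h A = blocks h (Aᵀ * J * A) := by
  simp only [blocks, Matrix.transpose_submatrix, Matrix.submatrix_mul_equiv]

theorem mem_isotropyGroup {A : SOLorentz (n + 2)} :
    A ∈ isotropyGroup h ↔ ∃ (B : SOLorentz (q + 2)) (C : Matrix.specialOrthogonalGroup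
      (Fin (n - q)) ℝ), blocks h ((A : GL (Fin (n + 2)) ℝ) : Matrix _ _ ℝ) =
        Matrix.fromBlocks ((B : GL (Fin (q + 2)) ℝ) : Matrix _ _ ℝ) 0 0 (C : Matrix _ _ ℝ) := by
  constructor
  · rintro ⟨⟨C, B⟩, rfl⟩
    exact ⟨B, C, (blocks_eq_iff h).2 rfl⟩
  · rintro ⟨B, C, hBC⟩
    exact ⟨(C, B), Subtype.ext (Units.ext ((blocks_eq_iff h).1 hBC))⟩

theorem forall_col_baseEmb_eq_sum_iff {A : Matrix (Fin (n + 2)) (Fin (n + 2)) ℝ}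
    {T : Matrix (Fin (q + 2)) (Fin (q + 2)) ℝ} :
    (∀ i, A.col (baseEmb h i) = ∑ j, T i j • stdFrame (baseEmb h) j) ↔
      (blocks h A).toBlocks₂₁ = 0 ∧ (blocks h A).toBlocks₁₁ = Tᵀ := by
  have hinl (i k : Fin (q + 2)) :
      (∑ j, T i j • stdFrame (baseEmb h) j) (blockIndex h (Sum.inl k)) = T i k := by
    simp [blockIndex_inl, stdFrame, Pi.single_apply]
  have hinr (i : Fin (q + 2)) (k : Fin (n - q)) :
      (∑ j, T i j • stdFrame (baseEmb h) j) (blockIndex h (Sum.inr k)) = 0 := by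
    simp [stdFrame, blockIndex_inr_ne_baseEmb]
  refine ⟨fun hcol => ⟨?_, ?_⟩, fun ⟨h₂₁, h₁₁⟩ i => funext fun k => ?_⟩
  · ext k i
    exact (congrFun (hcol i) _).trans (hinr i k)
  · ext k i
    exact (congrFun (hcol i) _).trans (hinl i k)
  · obtain ⟨k | k, rfl⟩ := (blockIndex h).surjective k
    · exact (congrFun (congrFun h₁₁ k) i).trans (hinl i k).symm
    · exact (congrFun (congrFun h₂₁ k) i).trans (hinr i k).symm

theorem smul_basePlane_eq_iff (A : SOLorentz (n + 2)) :
    A • (basePlane h : LorentzPlane q n) = basePlane h ↔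
      (blocks h ((A : GL (Fin (n + 2)) ℝ) : Matrix _ _ ℝ)).toBlocks₂₁ = 0 ∧
      0 < (blocks h ((A : GL (Fin (n + 2)) ℝ) : Matrix _ _ ℝ)).toBlocks₁₁.det := by
  have hframe := isFrame_basePlane (q := q) h
  have hcol (i : Fin (q + 2)) : glEquiv (A : GL (Fin (n + 2)) ℝ) (stdFrame (baseEmb h) i) =
      ((A : GL (Fin (n + 2)) ℝ) : Matrix _ _ ℝ).col (baseEmb h i) := by
    rw [glEquiv_apply, stdFrame, Matrix.mulVec_single_one]
  constructor
  · intro hA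
    obtain ⟨T, hT, hAT⟩ := hframe.exists_matrix (hA ▸ hframe.map A)
    obtain ⟨h₂₁, h₁₁⟩ := (forall_col_baseEmb_eq_sum_iff h).1
      fun i => (hcol i).symm.trans (congrFun hAT i)
    exact ⟨h₂₁, by rwa [h₁₁, Matrix.det_transpose]⟩
  · rintro ⟨h₂₁, hdet⟩
    refine hframe.eq_of_map A ?_
    simp only [hcol, (forall_col_baseEmb_eq_sum_iff h).2 ⟨h₂₁, (Matrix.transpose_transpose _).symm⟩]
    exact hframe.matrix_mul (by rwa [Matrix.det_transpose])

theorem fromBlocks_isometry {α β R : Type*} [Fintype α] [DecidableEq α] [Fintype β] [CommRing R]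
    {J P : Matrix α α R} {Q : Matrix α β R} {K S : Matrix β β R} (hJ : IsUnit J.det)
    (hiso : (Matrix.fromBlocks P Q 0 S)ᵀ * Matrix.fromBlocks J 0 0 K * Matrix.fromBlocks P Q 0 S =
      Matrix.fromBlocks J 0 0 K) : Pᵀ * J * P = J ∧ Q = 0 ∧ Sᵀ * K * S = K := by
  rw [Matrix.fromBlocks_transpose, Matrix.fromBlocks_multiply, Matrix.fromBlocks_multiply,
    Matrix.fromBlocks_inj] at hiso
  simp only [Matrix.mul_zero, Matrix.zero_mul, add_zero, zero_add, Matrix.transpose_zero] at hiso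
  obtain ⟨hP, hQ, -, hS⟩ := hiso
  have hunit : IsUnit (Pᵀ * J).det := by
    rw [← hP, Matrix.det_mul] at hJ
    exact isUnit_of_mul_isUnit_left hJ
  have hQ₀ : Q = 0 := by
    rw [← Matrix.nonsing_inv_mul_cancel_left _ Q hunit, hQ, Matrix.mul_zero]
  refine ⟨hP, hQ₀, ?_⟩
  rwa [hQ₀, Matrix.mul_zero, zero_add] at hS

theorem smul_basePlane_eq_iff_mem_isotropyGroup (A : SOLorentz (n + 2)) :
    A • (basePlane h : LorentzPlane q n) = basePlane h ↔ A ∈ isotropyGroup h := by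
  rw [smul_basePlane_eq_iff, mem_isotropyGroup]
  constructor
  · rintro ⟨h₂₁, hpos⟩
    set M := ((A : GL (Fin (n + 2)) ℝ) : Matrix (Fin (n + 2)) (Fin (n + 2)) ℝ)
    have hM : Matrix.fromBlocks (blocks h M).toBlocks₁₁ (blocks h M).toBlocks₁₂ 0
        (blocks h M).toBlocks₂₂ = blocks h M := by
      rw [← h₂₁, Matrix.fromBlocks_toBlocks]
    have hiso := transpose_blocks_mul_mul h M (minkowskiMatrix (n + 2))
    rw [A.2.1, blocks_minkowskiMatrix, ← hM] at hiso
    obtain ⟨hP, hQ, hS⟩ :=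
      fromBlocks_isometry (det_minkowskiMatrix_ne_zero (q + 2)).isUnit hiso
    have hPdet : (blocks h M).toBlocks₁₁.det = 1 := by nlinarith [det_mul_det_eq_one hP]
    have hSdet : (blocks h M).toBlocks₂₂.det = 1 := by
      have hMdet := (congrArg Matrix.det hM).trans ((det_blocks h M).trans A.2.2)
      rwa [Matrix.det_fromBlocks_zero₂₁, hPdet, one_mul] at hMdet
    refine ⟨⟨Matrix.GeneralLinearGroup.mkOfDetNeZero _ hpos.ne', hP, hPdet⟩, ⟨_,
      Matrix.mem_specialOrthogonalGroup_iff.2 ⟨(Matrix.mem_orthogonalGroup_iff' _ _).2 ?_, hSdet⟩⟩,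
      ?_⟩
    · simpa [Matrix.star_eq_conjTranspose] using hS
    · exact hM.symm.trans (congrArg (Matrix.fromBlocks _ · _ _) hQ)
  · rintro ⟨B, C, hBC⟩
    rw [hBC, Matrix.toBlocks_fromBlocks₂₁, Matrix.toBlocks_fromBlocks₁₁, B.2.2]
    exact ⟨rfl, one_pos⟩

theorem stabilizer_baseSphere :
    MulAction.stabilizer (SOLorentz (n + 2)) (baseSphere h : OrientedSphere q n) =
      isotropyGroup h := by
  ext A
  rw [MulAction.mem_stabilizer_iff, ← smul_basePlane_eq_iff_mem_isotropyGroup,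
    ← OrientedSphere.toPlane_injective.eq_iff, OrientedSphere.toPlane_smul, toPlane_baseSphere]

end Isotropy

/-! ### The homogeneous space -/

theorem isClosed_SOLorentz (m : ℕ) : IsClosed (SOLorentz m : Set (GL (Fin m) ℝ)) := by
  have hval : Continuous fun A : GL (Fin m) ℝ => (A : Matrix (Fin m) (Fin m) ℝ) :=
    Units.continuous_val
  exact (isClosed_eq ((hval.matrix_transpose.matrix_mul continuous_const).matrix_mul hval)
    continuous_const).inter (isClosed_eq hval.matrix_det continuous_const)

instance {M : Type*} [Monoid M] [TopologicalSpace M] [ContinuousMul M] [T1Space M]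
    [SigmaCompactSpace M] : SigmaCompactSpace Mˣ :=
  have : SigmaCompactSpace Mᵐᵒᵖ :=
    MulOpposite.opHomeomorph.symm.isClosedEmbedding.sigmaCompactSpace
  Units.isClosedEmbedding_embedProduct.sigmaCompactSpace

instance {m : ℕ} : SigmaCompactSpace (SOLorentz m) :=
  have : SigmaCompactSpace (Matrix (Fin m) (Fin m) ℝ) :=
    inferInstanceAs (SigmaCompactSpace (Fin m → Fin m → ℝ))
  (isClosed_SOLorentz m).isClosedEmbedding_subtypeVal.sigmaCompactSpace

theorem exists_homeomorph_quotient {G X : Type*} [TopologicalSpace G] [TopologicalSpace X]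
    [Group G] [IsTopologicalGroup G] [MulAction G X] [SigmaCompactSpace G] [BaireSpace X]
    [T2Space X] [ContinuousSMul G X] [MulAction.IsPretransitive G X] {x : X} {H : Subgroup G}
    (hH : MulAction.stabilizer G x = H) :
    ∃ φ : (G ⧸ H) ≃ₜ X, ∀ (g : G) (y : G ⧸ H), φ (g • y) = g • φ y := by
  subst hH
  have hmk : IsOpenQuotientMap (QuotientGroup.mk : G → G ⧸ MulAction.stabilizer G x) :=
    QuotientGroup.isOpenQuotientMap_mk
  have hcomp : MulAction.ofQuotientStabilizer G x ∘ QuotientGroup.mk = fun g : G => g • x :=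
    rfl
  have hcont : Continuous (MulAction.ofQuotientStabilizer G x) := by
    rw [hmk.isQuotientMap.continuous_iff, hcomp]
    fun_prop
  have hopen : IsOpenMap (MulAction.ofQuotientStabilizer G x) := fun U hU => by
    have horbit := isOpenMap_smul_of_sigmaCompact (G := G) x _ (hU.preimage hmk.continuous)
    rwa [← hcomp, Set.image_comp, Set.image_preimage_eq _ hmk.surjective] at horbit
  have hsurj : Function.Surjective (MulAction.ofQuotientStabilizer G x) := fun y => by
    obtain ⟨g, hg⟩ := MulAction.exists_smul_eq G x y
    exact ⟨QuotientGroup.mk g, hg⟩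
  let e := Equiv.ofBijective _ ⟨MulAction.injective_ofQuotientStabilizer G x, hsurj⟩
  exact ⟨e.toHomeomorphOfContinuousOpen hcont hopen,
    fun g y => MulAction.ofQuotientStabilizer_smul _ _ _ _⟩

theorem exists_homeomorph_orientedSphere {q n : ℕ} [hq : Fact (q < n)] :
    ∃ φ : (SOLorentz (n + 2) ⧸ isotropyGroup hq.out.le) ≃ₜ OrientedSphere q n,
      ∀ (A : SOLorentz (n + 2)) (x : SOLorentz (n + 2) ⧸ isotropyGroup hq.out.le),
        φ (A • x) = A • φ x :=
  have : T2Space (OrientedSphere q n) := (OrientedSphere.isEmbedding_plucker hq.out).t2Space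
  have : LocallyCompactSpace (OrientedSphere q n) :=
    ChartedSpace.locallyCompactSpace (Model q n) _
  have : MulAction.IsPretransitive (SOLorentz (n + 2)) (OrientedSphere q n) :=
    ⟨fun S S' => ⟨mover S' * (mover S)⁻¹, by
      rw [mul_smul, inv_smul_eq_iff.2 (mover_smul S).symm, mover_smul]⟩⟩
  exists_homeomorph_quotient (stabilizer_baseSphere hq.out.le)

/-! ### The derivative of the Plücker embedding -/

theorem hasDerivAt_det_one_add_smul {𝕜 ι : Type*} [NontriviallyNormedField 𝕜] [Fintype ι]
    [DecidableEq ι] (M : Matrix ι ι 𝕜) :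
    HasDerivAt (fun s : 𝕜 => (1 + s • M).det) M.trace 0 := by
  have hderiv := (1 + (Polynomial.X : Polynomial 𝕜) • M.map Polynomial.C).det.hasDerivAt 0
  rw [Matrix.derivative_det_one_add_X_smul] at hderiv
  refine hderiv.congr_of_eventuallyEq (.of_forall fun s => ?_)
  beta_reduce
  rw [← Polynomial.coe_evalRingHom, RingHom.map_det]
  congr 1
  ext i j
  simp [Matrix.one_apply, apply_ite, mul_comm s]

theorem minkowskiForm_eq_sum_eps {m : ℕ} (v w : Fin m → ℝ) :
    minkowskiForm m v w = ∑ k, eps k * v k * w k := by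
  rw [minkowskiForm, minkowskiMatrix_eq, Matrix.toBilin'_apply', dotProduct]
  exact Finset.sum_congr rfl fun k _ => by rw [Matrix.mulVec_diagonal]; ring

/-- The metric in a chart at its origin: the sign is that of the row of the coordinate in the
`(q + 2) × (n - q)` matrix. -/
def originForm (q n : ℕ) (Y Z : Model q n) : ℝ :=
  ∑ m, eps (finProdFinEquiv.symm m).1 * (Y m * Z m)

theorem originForm_smul_right {q n : ℕ} (s : ℝ) (Y Z : Model q n) :
    originForm q n Y (s • Z) = s * originForm q n Y Z := by
  simp only [originForm, Finset.mul_sum, PiLp.smul_apply, smul_eq_mul]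
  exact Finset.sum_congr rfl fun m _ => by ring

theorem originForm_zero_right {q n : ℕ} (Y : Model q n) : originForm q n Y 0 = 0 := by
  simp [originForm]

theorem eq_zero_of_originForm {q n : ℕ} {u : Model q n} (hu : ∀ v, originForm q n u v = 0) :
    u = 0 := by
  ext m
  simpa [originForm, eps_ne_zero] using hu (EuclideanSpace.single m 1)

theorem trace_eps_mul_sum_eq_originForm {q n : ℕ} (Y Z : Model q n) :
    (Matrix.of fun i l : Fin (q + 2) =>
      eps i * ∑ j, Y (finProdFinEquiv (i, j)) * Z (finProdFinEquiv (l, j))).trace =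
        originForm q n Y Z := by
  rw [originForm, ← finProdFinEquiv.sum_comp, Fintype.sum_prod_type]
  simp [Matrix.trace, Finset.mul_sum]

theorem hasFDerivAt_normalize {q n : ℕ} {E : Type*} [NormedAddCommGroup E]
    [NormedSpace ℝ E] {f : E → PluckerSpace q n} {f' : E →L[ℝ] PluckerSpace q n} {x : E}
    (hf : HasFDerivAt f f' x) (hunit : pluckerForm q n (f x) (f x) = 1)
    (horth : ∀ v, pluckerForm q n (f' v) (f x) = 0) :
    HasFDerivAt (fun y => normalize (f y)) f' x := by
  have hsq : HasFDerivAt (fun y => pluckerForm q n (f y) (f y)) (0 : E →L[ℝ] ℝ) x := by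
    refine (((pluckerForm q n).toContinuousBilinearMap.hasFDerivAt.comp x hf).clm_apply
      hf).congr_fderiv ?_
    ext v
    simp [horth, pluckerForm_comm _ (f' v)]
  have hinv : DifferentiableAt ℝ (fun t : ℝ => (√t)⁻¹) (pluckerForm q n (f x) (f x)) := by
    rw [hunit]
    exact (Real.hasDerivAt_sqrt one_ne_zero).differentiableAt.inv (by simp)
  refine ((hinv.hasDerivAt.comp_hasFDerivAt x hsq).smul hf).congr_fderiv ?_
  ext v : 1
  simp [hunit]

section OriginDerivative

variable {q n : ℕ} (h : q ≤ n)

theorem minkowskiForm_graphFrame (X Y : Model q n) (i l : Fin (q + 2)) :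
    minkowskiForm (n + 2) (graphFrame h X i) (graphFrame h Y l) =
      (if i = l then eps i else 0) +
        ∑ j, X (finProdFinEquiv (i, j)) * Y (finProdFinEquiv (l, j)) := by
  rw [minkowskiForm_eq_sum_eps, ← (blockIndex h).sum_comp, Fintype.sum_sum_type]
  congr 1
  · simp only [blockIndex_inl, graphFrame_baseEmb, eps_baseEmb, mul_ite, mul_one, mul_zero]
    rw [Finset.sum_ite_eq]
    by_cases hil : i = l <;> simp [hil]
  · simp only [graphFrame_inr, eps_inr, one_mul]

theorem pluckerForm_wedge_graphFrame (X Y : Model q n) :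
    pluckerForm q n (wedge (graphFrame h X)) (wedge (graphFrame h Y)) =
      (1 + Matrix.of fun i l => eps i *
        ∑ j, X (finProdFinEquiv (i, j)) * Y (finProdFinEquiv (l, j))).det := by
  have hgram :
      (Matrix.of fun i l => minkowskiForm (n + 2) (graphFrame h X i) (graphFrame h Y l)) =
        Matrix.diagonal eps * (1 + Matrix.of fun i l => eps i *
          ∑ j, X (finProdFinEquiv (i, j)) * Y (finProdFinEquiv (l, j))) := by
    ext i l
    rw [Matrix.diagonal_mul, Matrix.of_apply, minkowskiForm_graphFrame, Matrix.add_apply,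
      Matrix.of_apply, mul_add, ← mul_assoc, eps_mul_self, one_mul, Matrix.one_apply, mul_ite,
      mul_one, mul_zero]
  rw [pluckerForm_wedge, hgram, Matrix.det_mul, Matrix.det_diagonal, prod_eps, neg_mul, one_mul,
    neg_neg]

theorem hasDerivAt_pluckerForm_wedge_graphFrame (Y Z : Model q n) :
    HasDerivAt (fun s : ℝ => pluckerForm q n (wedge (graphFrame h (s • Y)))
      (wedge (graphFrame h Z))) (originForm q n Y Z) 0 := by
  rw [← trace_eps_mul_sum_eq_originForm]
  refine (hasDerivAt_det_one_add_smul _).congr_of_eventuallyEq (.of_forall fun s => ?_)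
  beta_reduce
  rw [pluckerForm_wedge_graphFrame]
  congr 2
  ext i l
  simp only [Matrix.of_apply, Matrix.smul_apply, smul_eq_mul, PiLp.smul_apply, Finset.mul_sum]
  exact Finset.sum_congr rfl fun j _ => by ring

/-- The derivative at the origin of the map that sends `X` to the wedge of the rows of `(1 | X)`. -/
def wedgeDeriv : Model q n →L[ℝ] PluckerSpace q n :=
  fderiv ℝ (fun X : Model q n => (wedge (graphFrame h X) : PluckerSpace q n)) 0

theorem hasFDerivAt_wedge_graphFrame :
    HasFDerivAt (fun X : Model q n => (wedge (graphFrame h X) : PluckerSpace q n))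
      (wedgeDeriv h) 0 :=
  ((contDiff_wedge_graphFrame h (m := 1)).differentiable one_ne_zero).differentiableAt.hasFDerivAt

theorem hasDerivAt_wedge_graphFrame (Y : Model q n) :
    HasDerivAt (fun s : ℝ => (wedge (graphFrame h (s • Y)) : PluckerSpace q n))
      (wedgeDeriv h Y) 0 := by
  have hline : HasDerivAt (fun s : ℝ => s • Y) Y 0 := by
    simpa using (hasDerivAt_id (0 : ℝ)).smul_const Y
  exact HasFDerivAt.comp_hasDerivAt_of_eq (0 : ℝ) (hasFDerivAt_wedge_graphFrame h) hline
    (zero_smul ℝ Y).symm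

theorem pluckerForm_wedgeDeriv_wedge (Y Z : Model q n) :
    pluckerForm q n (wedgeDeriv h Y) (wedge (graphFrame h Z)) = originForm q n Y Z :=
  (((pluckerForm q n).toContinuousBilinearMap.flip (wedge (graphFrame h Z))).hasFDerivAt
    |>.comp_hasDerivAt (0 : ℝ) (hasDerivAt_wedge_graphFrame h Y)).unique
    (hasDerivAt_pluckerForm_wedge_graphFrame h Y Z)

theorem pluckerForm_wedgeDeriv (Y Z : Model q n) :
    pluckerForm q n (wedgeDeriv h Y) (wedgeDeriv h Z) = originForm q n Y Z := by
  have hleft := ((pluckerForm q n).toContinuousBilinearMap (wedgeDeriv h Y)).hasFDerivAt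
    |>.comp_hasDerivAt (0 : ℝ) (hasDerivAt_wedge_graphFrame h Z)
  have hright : HasDerivAt (fun s : ℝ => s * originForm q n Y Z) (originForm q n Y Z) 0 := by
    simpa using (hasDerivAt_id (0 : ℝ)).mul_const (originForm q n Y Z)
  refine hleft.unique (hright.congr_of_eventuallyEq (.of_forall fun s => ?_))
  exact (pluckerForm_wedgeDeriv_wedge h Y (s • Z)).trans (originForm_smul_right s Y Z)

theorem hasFDerivAt_graphPlucker :
    HasFDerivAt (graphPlucker h : Model q n → PluckerSpace q n) (wedgeDeriv h) 0 := by
  refine hasFDerivAt_normalize (hasFDerivAt_wedge_graphFrame h) ?_ fun Y => ?_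
  · rw [graphFrame_zero, (isPseudoOrthonormal_stdFrame h).pluckerForm_wedge]
  · rw [pluckerForm_wedgeDeriv_wedge, originForm_zero_right]

end OriginDerivative

section Differential

variable {q n : ℕ} [hq : Fact (q < n)]

theorem extChartAt_orientedSphere_self (S : OrientedSphere q n) :
    extChartAt (𝓡 ((q + 2) * (n - q))) S S = 0 := by
  change graphCoord hq.out.le ((mover S)⁻¹ • S).plucker = 0
  rw [inv_smul_eq_iff.2 (mover_smul S).symm, ← graphSphere_zero,
    plucker_graphSphere _ (zero_mem_graphDomain _),
    graphCoord_graphPlucker _ (zero_mem_graphDomain _)]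

theorem hasFDerivAt_writtenInExtChartAt_plucker (S : OrientedSphere q n) :
    HasFDerivAt (writtenInExtChartAt (𝓡 ((q + 2) * (n - q))) 𝓘(ℝ, PluckerSpace q n) S
        (OrientedSphere.plucker : OrientedSphere q n → PluckerSpace q n))
      ((compound (mover S : GL (Fin (n + 2)) ℝ)).toContinuousLinearMap ∘L wedgeDeriv hq.out.le)
      (0 : Model q n) := by
  have hcomp : HasFDerivAt
      (compound (mover S : GL (Fin (n + 2)) ℝ) ∘ graphPlucker hq.out.le)
      ((compound (mover S : GL (Fin (n + 2)) ℝ)).toContinuousLinearMap ∘L wedgeDeriv hq.out.le)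
      (0 : Model q n) :=
    (LinearMap.toContinuousLinearMap (compound (mover S : GL (Fin (n + 2)) ℝ) :
      PluckerSpace q n →ₗ[ℝ] PluckerSpace q n)).hasFDerivAt.comp _
      (hasFDerivAt_graphPlucker hq.out.le)
  refine hcomp.congr_of_eventuallyEq ?_
  filter_upwards [(isOpen_graphDomain hq.out.le).mem_nhds (zero_mem_graphDomain _)] with X hX
  change (mover S • graphSphere _ X).plucker = _
  rw [OrientedSphere.plucker_smul, plucker_graphSphere _ hX]
  rfl

theorem mfderiv_plucker (S : OrientedSphere q n) (u : Model q n) :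
    mfderiv (𝓡 ((q + 2) * (n - q))) 𝓘(ℝ, PluckerSpace q n)
      (OrientedSphere.plucker : OrientedSphere q n → PluckerSpace q n) S u =
      compound (mover S : GL (Fin (n + 2)) ℝ) (wedgeDeriv hq.out.le u) := by
  rw [(contMDiff_plucker.mdifferentiableAt (by simp)).mfderiv, extChartAt_orientedSphere_self]
  simp only [modelWithCornersSelf_coe, Set.range_id, fderivWithin_univ]
  rw [(hasFDerivAt_writtenInExtChartAt_plucker S).fderiv]
  rfl

theorem pluckerForm_mfderiv_plucker (S : OrientedSphere q n) (u v : Model q n) :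
    pluckerForm q n
      (mfderiv (𝓡 ((q + 2) * (n - q))) 𝓘(ℝ, PluckerSpace q n)
        (OrientedSphere.plucker : OrientedSphere q n → PluckerSpace q n) S u)
      (mfderiv (𝓡 ((q + 2) * (n - q))) 𝓘(ℝ, PluckerSpace q n)
        (OrientedSphere.plucker : OrientedSphere q n → PluckerSpace q n) S v) =
      originForm q n u v := by
  rw [mfderiv_plucker, mfderiv_plucker, pluckerForm_compound, pluckerForm_wedgeDeriv]

theorem mfderiv_plucker_mfderiv_smul (A : SOLorentz (n + 2)) (S : OrientedSphere q n)
    (u : TangentSpace (𝓡 ((q + 2) * (n - q))) S) :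
    mfderiv (𝓡 ((q + 2) * (n - q))) 𝓘(ℝ, PluckerSpace q n)
      (OrientedSphere.plucker : OrientedSphere q n → PluckerSpace q n) (A • S)
      (mfderiv (𝓡 ((q + 2) * (n - q))) (𝓡 ((q + 2) * (n - q)))
        (fun T : OrientedSphere q n => A • T) S u) =
    compound (A : GL (Fin (n + 2)) ℝ) (mfderiv (𝓡 ((q + 2) * (n - q))) 𝓘(ℝ, PluckerSpace q n)
      (OrientedSphere.plucker : OrientedSphere q n → PluckerSpace q n) S u) := by
  have hequivariant : OrientedSphere.plucker ∘ (fun S : OrientedSphere q n => A • S) =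
      (compound (A : GL (Fin (n + 2)) ℝ)).toContinuousLinearMap ∘ OrientedSphere.plucker :=
    funext fun t => OrientedSphere.plucker_smul _ _
  have hψ (S : OrientedSphere q n) : MDifferentiableAt (𝓡 ((q + 2) * (n - q)))
      𝓘(ℝ, PluckerSpace q n) OrientedSphere.plucker S :=
    contMDiff_plucker.mdifferentiableAt (by simp)
  have hcomp := mfderiv_comp S (hψ (A • S))
    ((contMDiff_smul_orientedSphere A).mdifferentiableAt (by simp))
  rw [hequivariant, mfderiv_comp S (ContinuousLinearMap.mdifferentiableAt _) (hψ S),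
    ContinuousLinearMap.mfderiv_eq] at hcomp
  exact (congrArg (fun L : Model q n →L[ℝ] PluckerSpace q n => L u) hcomp).symm

end Differential

/-! ### The induced metric -/

section PullbackForm

variable {E H : Type*} [NormedAddCommGroup E] [NormedSpace ℝ E] [TopologicalSpace H]
  {I : ModelWithCorners ℝ E H} {M : Type*} [TopologicalSpace M] [ChartedSpace H M]
  {V : Type*} [NormedAddCommGroup V] [NormedSpace ℝ V]

/-- The pullback of a bilinear form along a linear map, as a continuous bilinear form. -/
def pullbackForm (B : V →L[ℝ] V →L[ℝ] ℝ) (T : E →L[ℝ] V) : E →L[ℝ] E →L[ℝ] ℝ :=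
  B.bilinearComp T T

theorem pullbackForm_apply (B : V →L[ℝ] V →L[ℝ] ℝ) (T : E →L[ℝ] V) (u v : E) :
    pullbackForm B T u v = B (T u) (T v) := rfl

theorem contDiff_pullbackForm {m : WithTop ℕ∞} (B : V →L[ℝ] V →L[ℝ] ℝ) :
    ContDiff ℝ m (pullbackForm B : (E →L[ℝ] V) → _) :=
  (ContinuousLinearMap.compL ℝ E V ℝ).flip.contDiff.clm_comp
    (contDiff_const.clm_comp contDiff_id)

variable [IsManifold I ∞ M]

theorem inTangentCoordinates_mfderiv_apply (f : M → V) {x₀ x : M}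
    (hx : x ∈ (trivializationAt E (TangentSpace I) x₀).baseSet) (w : E) :
    inTangentCoordinates I 𝓘(ℝ, V) id f (mfderiv I 𝓘(ℝ, V) f) x₀ x w =
      mfderiv I 𝓘(ℝ, V) f x ((trivializationAt E (TangentSpace I) x₀).symm x w) := by
  have hcomp : inTangentCoordinates I 𝓘(ℝ, V) id f (mfderiv I 𝓘(ℝ, V) f) x₀ x =
      (trivializationAt V (TangentSpace 𝓘(ℝ, V)) (f x₀)).continuousLinearMapAt ℝ (f x) ∘L
        (mfderiv I 𝓘(ℝ, V) f x ∘L (trivializationAt E (TangentSpace I) x₀).symmL ℝ x) := rfl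
  rw [hcomp, TangentBundle.continuousLinearMapAt_model_space]
  exact congrArg _ (Bundle.Trivialization.symmL_apply _ hx _)

theorem contMDiff_pullbackForm_mfderiv (B : V →L[ℝ] V →L[ℝ] ℝ) {f : M → V}
    (hf : ContMDiff I 𝓘(ℝ, V) ∞ f) :
    ContMDiff I (I.prod 𝓘(ℝ, E →L[ℝ] E →L[ℝ] ℝ)) ∞
    (fun p => Bundle.TotalSpace.mk' (E →L[ℝ] E →L[ℝ] ℝ)
      (E := fun p : M => TangentSpace I p →L[ℝ] TangentSpace I p →L[ℝ] ℝ) p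
        (pullbackForm (E := E) B (mfderiv I 𝓘(ℝ, V) f p))) := by
  intro x₀
  have hcoord : ContMDiffAt I 𝓘(ℝ, E →L[ℝ] V) ∞
      (inTangentCoordinates I 𝓘(ℝ, V) id f (mfderiv I 𝓘(ℝ, V) f) x₀) x₀ :=
    hf.contMDiffAt.mfderiv_const (by simp)
  have hpull := (contDiff_pullbackForm (E := E) B).contMDiff.contMDiffAt.comp x₀ hcoord
  rw [contMDiffAt_hom_bundle]
  refine ⟨contMDiffAt_id, hpull.congr_of_eventuallyEq ?_⟩
  have hx₀ : (trivializationAt E (TangentSpace I) x₀).baseSet ∈ 𝓝 x₀ :=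
    (trivializationAt E (TangentSpace I) x₀).open_baseSet.mem_nhds
      (FiberBundle.mem_baseSet_trivializationAt' x₀)
  filter_upwards [hx₀] with x hx
  ext u v
  refine (inCoordinates_apply_eq₂ (E₃ := Bundle.Trivial M ℝ) hx hx (Set.mem_univ _)).trans ?_
  rw [Function.comp_apply, pullbackForm_apply, inTangentCoordinates_mfderiv_apply f hx,
    inTangentCoordinates_mfderiv_apply f hx]
  simp only [Bundle.Trivial.fiberBundle_trivializationAt',
    Bundle.Trivial.linearMapAt_trivialization]
  rfl

end PullbackForm

section Metric

variable {q n : ℕ} [Fact (q < n)]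

/-- The pseudo-Riemannian metric of the space of spheres, induced by the Minkowski form through the
Plücker embedding. -/
def sphereMetric : PseudoRiemannianMetric (𝓡 ((q + 2) * (n - q))) (OrientedSphere q n) where
  val S := pullbackForm (E := Model q n) (pluckerForm q n).toContinuousBilinearMap
    (mfderiv (𝓡 ((q + 2) * (n - q))) 𝓘(ℝ, PluckerSpace q n) OrientedSphere.plucker S)
  symm _ _ _ := pluckerForm_comm _ _
  nondegenerate S u hu := eq_zero_of_originForm fun v =>
    (pluckerForm_mfderiv_plucker S u v).symm.trans (hu v)
  contMDiff := contMDiff_pullbackForm_mfderiv _ contMDiff_plucker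

theorem sphereMetric_val_mfderiv_smul (A : SOLorentz (n + 2)) (S : OrientedSphere q n)
    (u v : TangentSpace (𝓡 ((q + 2) * (n - q))) S) :
    sphereMetric.val (A • S)
      (mfderiv (𝓡 ((q + 2) * (n - q))) (𝓡 ((q + 2) * (n - q)))
        (fun T : OrientedSphere q n => A • T) S u)
      (mfderiv (𝓡 ((q + 2) * (n - q))) (𝓡 ((q + 2) * (n - q)))
        (fun T : OrientedSphere q n => A • T) S v) = sphereMetric.val S u v :=
  (congrArg₂ (fun a b => pluckerForm q n a b) (mfderiv_plucker_mfderiv_smul A S u)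
    (mfderiv_plucker_mfderiv_smul A S v)).trans (pluckerForm_compound A _ _)

end Metric

/-! ### The index of the metric -/

theorem isCompl_spanSubset {R ι : Type*} [Ring R] [Nontrivial R] [Finite ι] {s t : Set ι}
    (hst : IsCompl s t) : IsCompl (Pi.spanSubset R s) (Pi.spanSubset R t) :=
  (Pi.basisFun R ι).linearIndependent.isCompl_span_image (Pi.basisFun R ι).span_eq hst

theorem sum_mul_self_pos_of_mem_spanSubset {𝕜 ι : Type*} [Fintype ι] [Ring 𝕜] [LinearOrder 𝕜]
    [IsStrictOrderedRing 𝕜] {w v : ι → 𝕜} {s : Set ι} (hs : ∀ m ∈ s, 0 < w m)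
    (hv : v ∈ Pi.spanSubset 𝕜 s) (hv₀ : v ≠ 0) : 0 < ∑ m, w m * (v m * v m) := by
  rw [Pi.mem_spanSubset_iff] at hv
  obtain ⟨k, hk⟩ := Function.ne_iff.1 hv₀
  refine Finset.sum_pos' (fun m _ => ?_) ⟨k, Finset.mem_univ k,
    mul_pos (hs k (not_imp_comm.1 (hv k) hk)) (mul_self_pos.2 hk)⟩
  by_cases hm : m ∈ s
  · exact mul_nonneg (hs m hm).le (mul_self_nonneg _)
  · rw [hv m hm, mul_zero, mul_zero]

theorem exists_isCompl_sum_mul_self {ι : Type*} [Fintype ι] {w : ι → ℝ} (hw : ∀ m, w m ≠ 0) :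
    ∃ Vpos Vneg : Submodule ℝ (EuclideanSpace ℝ ι), IsCompl Vpos Vneg ∧
      finrank ℝ Vpos = {m | 0 < w m}.ncard ∧ finrank ℝ Vneg = {m | w m < 0}.ncard ∧
      (∀ v ∈ Vpos, v ≠ 0 → 0 < ∑ m, w m * (v m * v m)) ∧
      ∀ v ∈ Vneg, v ≠ 0 → ∑ m, w m * (v m * v m) < 0 := by
  let e := WithLp.linearEquiv 2 ℝ (ι → ℝ)
  have hcompl : IsCompl {m | 0 < w m} {m | w m < 0} := by
    have hneg : {m | w m < 0} = {m | 0 < w m}ᶜ := by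
      ext m
      simpa using (hw m).le_iff_lt.symm
    exact hneg ▸ isCompl_compl
  refine ⟨(Pi.spanSubset ℝ {m | 0 < w m}).map e.symm.toLinearMap,
    (Pi.spanSubset ℝ {m | w m < 0}).map e.symm.toLinearMap,
    (isCompl_spanSubset hcompl).map (Submodule.orderIsoMapComap e.symm),
    (e.symm.finrank_map_eq _).trans Pi.dim_spanSubset,
    (e.symm.finrank_map_eq _).trans Pi.dim_spanSubset, ?_, ?_⟩
  · rintro _ ⟨v, hv, rfl⟩ hv₀
    exact sum_mul_self_pos_of_mem_spanSubset (fun _ hm => hm) hv (by rintro rfl; simp at hv₀)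
  · rintro _ ⟨v, hv, rfl⟩ hv₀
    have hpos := sum_mul_self_pos_of_mem_spanSubset (w := -w) (fun _ hm => neg_pos.2 hm) hv
      (by rintro rfl; simp at hv₀)
    simp only [Pi.neg_apply, neg_mul, Finset.sum_neg_distrib, Left.neg_pos_iff] at hpos
    exact hpos

theorem ncard_setOf_finProdFinEquiv_symm_fst_mem {a b : ℕ} (s : Set (Fin a)) :
    {m : Fin (a * b) | (finProdFinEquiv.symm m).1 ∈ s}.ncard = s.ncard * b := by
  have himage : {m : Fin (a * b) | (finProdFinEquiv.symm m).1 ∈ s} =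
      finProdFinEquiv '' (s ×ˢ Set.univ) := by
    ext m
    simp [Equiv.image_eq_preimage_symm]
  rw [himage, Set.ncard_image_of_injective _ finProdFinEquiv.injective, Set.ncard_prod,
    Set.ncard_univ, Nat.card_fin]

theorem setOf_eps_neg (m : ℕ) : {i : Fin (m + 1) | eps i < 0} = {0} := by
  ext i
  obtain rfl | hi := eq_or_ne i 0
  · simp [eps_zero]
  · simp [eps_of_ne_zero hi, hi, zero_le_one]

theorem setOf_eps_pos (m : ℕ) : {i : Fin (m + 1) | 0 < eps i} = {0}ᶜ := by
  ext i
  obtain rfl | hi := eq_or_ne i 0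
  · simp [eps_zero]
  · simp [eps_of_ne_zero hi, hi]

theorem exists_isCompl_originForm (q n : ℕ) :
    ∃ Vpos Vneg : Submodule ℝ (Model q n), IsCompl Vpos Vneg ∧
      finrank ℝ Vpos = (q + 1) * (n - q) ∧ finrank ℝ Vneg = n - q ∧
      (∀ v ∈ Vpos, v ≠ 0 → 0 < originForm q n v v) ∧
      ∀ v ∈ Vneg, v ≠ 0 → originForm q n v v < 0 := by
  obtain ⟨Vpos, Vneg, hcompl, hpos, hneg, hforms⟩ :=
    exists_isCompl_sum_mul_self fun m : Fin ((q + 2) * (n - q)) =>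
      eps_ne_zero (finProdFinEquiv.symm m).1
  refine ⟨Vpos, Vneg, hcompl, hpos.trans ?_, hneg.trans ?_, hforms⟩
  · refine (ncard_setOf_finProdFinEquiv_symm_fst_mem {i | 0 < eps i}).trans ?_
    rw [setOf_eps_pos, Set.ncard_compl, Set.ncard_singleton, Nat.card_fin, Nat.add_succ_sub_one]
  · refine (ncard_setOf_finProdFinEquiv_symm_fst_mem {i | eps i < 0}).trans ?_
    rw [setOf_eps_neg, Set.ncard_singleton, one_mul]

theorem exists_isCompl_sphereMetric {q n : ℕ} [Fact (q < n)] (S : OrientedSphere q n) :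
    ∃ Vpos Vneg : Submodule ℝ (TangentSpace (𝓡 ((q + 2) * (n - q))) S), IsCompl Vpos Vneg ∧
      finrank ℝ Vpos = (q + 1) * (n - q) ∧ finrank ℝ Vneg = n - q ∧
      (∀ v ∈ Vpos, v ≠ 0 → 0 < sphereMetric.val S v v) ∧
      ∀ v ∈ Vneg, v ≠ 0 → sphereMetric.val S v v < 0 := by
  obtain ⟨Vpos, Vneg, hcompl, hdimpos, hdimneg, hpos, hneg⟩ := exists_isCompl_originForm q n
  exact ⟨Vpos, Vneg, hcompl, hdimpos, hdimneg,
    fun v hv hv₀ => (hpos v hv hv₀).trans_eq (pluckerForm_mfderiv_plucker S v v).symm,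
    fun v hv hv₀ => (pluckerForm_mfderiv_plucker S v v).trans_lt (hneg v hv hv₀)⟩

end SphereSpace

end

open SphereSpace in
theorem mainTheorem5_general (q n : ℕ) (hqn : q < n) :
    Function.Bijective (OrientedSphere.toPlane : OrientedSphere q n → LorentzPlane q n) ∧
    ∃ (_ : TopologicalSpace (OrientedSphere q n))
      (_ : ChartedSpace (EuclideanSpace ℝ (Fin ((q + 2) * (n - q)))) (OrientedSphere q n))
      (_ : IsManifold (𝓡 ((q + 2) * (n - q))) ∞ (OrientedSphere q n))
      (_ : MulAction (SOLorentz (n + 2)) (OrientedSphere q n)),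
      Manifold.IsSmoothEmbedding (𝓡 ((q + 2) * (n - q))) 𝓘(ℝ, PluckerSpace q n) ∞
        (OrientedSphere.plucker : OrientedSphere q n → PluckerSpace q n) ∧
      (∀ (A : SOLorentz (n + 2)) (S : OrientedSphere q n), (A • S).toPlane = A • S.toPlane) ∧
      IsSmoothMatrixAction (𝓡 ((q + 2) * (n - q))) (OrientedSphere q n) (SOLorentz (n + 2)) ∧
      (∃ φ : (SOLorentz (n + 2) ⧸ isotropyGroup hqn.le) ≃ₜ OrientedSphere q n,
        ∀ (A : SOLorentz (n + 2)) (x : SOLorentz (n + 2) ⧸ isotropyGroup hqn.le),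
          φ (A • x) = A • φ x) ∧
      (∀ S : OrientedSphere q n,
        finrank ℝ (TangentSpace (𝓡 ((q + 2) * (n - q))) S) = (q + 2) * (n - q)) ∧
      ∃ g : PseudoRiemannianMetric (𝓡 ((q + 2) * (n - q))) (OrientedSphere q n),
        (∀ (S : OrientedSphere q n) (u v : TangentSpace (𝓡 ((q + 2) * (n - q))) S),
          g.val S u v = pluckerForm q n
            (mfderiv (𝓡 ((q + 2) * (n - q))) 𝓘(ℝ, PluckerSpace q n) OrientedSphere.plucker S u)
            (mfderiv (𝓡 ((q + 2) * (n - q))) 𝓘(ℝ, PluckerSpace q n)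
              OrientedSphere.plucker S v)) ∧
        (∀ (A : SOLorentz (n + 2)) (S : OrientedSphere q n)
          (u v : TangentSpace (𝓡 ((q + 2) * (n - q))) S),
          g.val (A • S)
            (mfderiv (𝓡 ((q + 2) * (n - q))) (𝓡 ((q + 2) * (n - q)))
              (fun T : OrientedSphere q n => A • T) S u)
            (mfderiv (𝓡 ((q + 2) * (n - q))) (𝓡 ((q + 2) * (n - q)))
              (fun T : OrientedSphere q n => A • T) S v) = g.val S u v) ∧
        ∀ S : OrientedSphere q n,
          ∃ Vpos Vneg : Submodule ℝ (TangentSpace (𝓡 ((q + 2) * (n - q))) S),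
            IsCompl Vpos Vneg ∧
            finrank ℝ Vpos = (q + 1) * (n - q) ∧
            finrank ℝ Vneg = n - q ∧
            (∀ v ∈ Vpos, v ≠ 0 → 0 < g.val S v v) ∧
            (∀ v ∈ Vneg, v ≠ 0 → g.val S v v < 0) := by
  have : Fact (q < n) := ⟨hqn⟩
  exact ⟨OrientedSphere.toPlane_bijective, inferInstance, inferInstance, inferInstance,
    inferInstance, isSmoothEmbedding_plucker, OrientedSphere.toPlane_smul,
    isSmoothMatrixAction_orientedSphere, exists_homeomorph_orientedSphere,
    fun _ => finrank_euclideanSpace_fin, sphereMetric, fun _ _ _ => rfl,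
    sphereMetric_val_mfderiv_smul, exists_isCompl_sphereMetric⟩

theorem mainTheorem5 (q n : ℕ) (hqn : q + 2 ≤ n) :
      -- oriented spheres are the same as oriented Lorentzian planes
    Function.Bijective
      (SphereSpace.OrientedSphere.toPlane :
        SphereSpace.OrientedSphere q n → SphereSpace.LorentzPlane q n) ∧
    ∃ (_ : TopologicalSpace (SphereSpace.OrientedSphere q n))
      (_ : ChartedSpace (EuclideanSpace ℝ (Fin ((q + 2) * (n - q))))
        (SphereSpace.OrientedSphere q n))
      (_ : IsManifold (𝓡 ((q + 2) * (n - q))) ∞ (SphereSpace.OrientedSphere q n))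
      (_ : MulAction (SphereSpace.SOLorentz (n + 2)) (SphereSpace.OrientedSphere q n)),
      -- the manifold is a submanifold of the exterior power
      Manifold.IsSmoothEmbedding (𝓡 ((q + 2) * (n - q))) 𝓘(ℝ, SphereSpace.PluckerSpace q n) ∞
        (SphereSpace.OrientedSphere.plucker :
          SphereSpace.OrientedSphere q n → SphereSpace.PluckerSpace q n) ∧
      -- the Moebius action, read off from the action on planes, is smooth
      (∀ (A : SphereSpace.SOLorentz (n + 2)) (S : SphereSpace.OrientedSphere q n),
        (A • S).toPlane = A • S.toPlane) ∧
      SphereSpace.IsSmoothMatrixAction (𝓡 ((q + 2) * (n - q))) (SphereSpace.OrientedSphere q n)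
        (SphereSpace.SOLorentz (n + 2)) ∧
      -- homogeneous space
      (∃ φ : (SphereSpace.SOLorentz (n + 2) ⧸
            SphereSpace.isotropyGroup (show q ≤ n by omega)) ≃ₜ SphereSpace.OrientedSphere q n,
        ∀ (A : SphereSpace.SOLorentz (n + 2)) (x : SphereSpace.SOLorentz (n + 2) ⧸
          SphereSpace.isotropyGroup (show q ≤ n by omega)), φ (A • x) = A • φ x) ∧
      (∀ S : SphereSpace.OrientedSphere q n,
      -- dimension
        Module.finrank ℝ (TangentSpace (𝓡 ((q + 2) * (n - q))) S) = (q + 2) * (n - q)) ∧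
      ∃ g : SphereSpace.PseudoRiemannianMetric (𝓡 ((q + 2) * (n - q)))
          (SphereSpace.OrientedSphere q n),
      -- the metric is induced by the Minkowski form
        (∀ (S : SphereSpace.OrientedSphere q n) (u v : TangentSpace (𝓡 ((q + 2) * (n - q))) S),
          g.val S u v = SphereSpace.pluckerForm q n
            (mfderiv (𝓡 ((q + 2) * (n - q))) 𝓘(ℝ, SphereSpace.PluckerSpace q n)
              SphereSpace.OrientedSphere.plucker S u)
            (mfderiv (𝓡 ((q + 2) * (n - q))) 𝓘(ℝ, SphereSpace.PluckerSpace q n)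
              SphereSpace.OrientedSphere.plucker S v)) ∧
      -- the metric is invariant
        (∀ (A : SphereSpace.SOLorentz (n + 2)) (S : SphereSpace.OrientedSphere q n)
          (u v : TangentSpace (𝓡 ((q + 2) * (n - q))) S),
          g.val (A • S)
            (mfderiv (𝓡 ((q + 2) * (n - q))) (𝓡 ((q + 2) * (n - q)))
              (fun T : SphereSpace.OrientedSphere q n => A • T) S u)
            (mfderiv (𝓡 ((q + 2) * (n - q))) (𝓡 ((q + 2) * (n - q)))
              (fun T : SphereSpace.OrientedSphere q n => A • T) S v) = g.val S u v) ∧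
      -- index
        ∀ S : SphereSpace.OrientedSphere q n,
          ∃ Vpos Vneg : Submodule ℝ (TangentSpace (𝓡 ((q + 2) * (n - q))) S),
            IsCompl Vpos Vneg ∧
            Module.finrank ℝ Vpos = (q + 1) * (n - q) ∧
            Module.finrank ℝ Vneg = n - q ∧
            (∀ v ∈ Vpos, v ≠ 0 → 0 < g.val S v v) ∧
            (∀ v ∈ Vneg, v ≠ 0 → g.val S v v < 0) :=
  mainTheorem5_general q n (by omega)
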